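/- **Setting.** Let $G$ be a plane triangulation with $n\ge 3$ nodes, that is, a connected simple graph with a fixed planar embedding in which every face (including the external one) is bounded by three edges. Let $T$ be a rooted spanning tree of $G$. Two distinct nodes are *unrelated* if neither is an ancestor of the other in $T$. Let $v_1,\dots,v_n$ be the counterclockwise preordering of $T$: $v_1$ is the root, and the children of a node are visited in counterclockwise order, starting from its parent (for the root, which lies on the external face, starting from the external face). $T$ is an *orderly spanning tree* of $G$ if $v_1$ lies on the external face and, for each $i$, the neighbors of $v_i$ in $G$ form, in counterclockwise order around $v_i$, the following four (possibly empty) blocks: the parent of $v_i$; the neighbors $v_j$ with $j<i$ unrelated to $v_i$; the children of $v_i$; the neighbors $v_j$ with $j>i$ unrelated to $v_i$. A *2-visibility drawing* of $G$ assigns to its nodes non-overlapping axis-parallel rectangles with integer corner coordinates, each at least $1\times1$, such that the rectangles of any two adjacent nodes are visible to each other horizontally or vertically, i.e. some horizontal (vertical) segment joins interior points of their facing sides without meeting any other rectangle. Its height and width are those of its bounding box. **Algorithm $\mathrm{draw}(G,T)$.** Starting from the empty drawing, for $i=1,\dots,n$: 1. If $i\neq1$ and $v_i$ is not the first child of its parent,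 lengthen each ancestor of $v_i$ to the right by one unit. 2. Draw $v_i$ as a unit square directly beneath its parent, aligned with the right side of its parent. 3. Lengthen nodes downward, unit by unit and only where necessary, until any two drawn nodes joined by an edge of $G$ not in $T$ are horizontally visible to each other: as long as this fails, every drawn node $u$ that is not yet horizontally visible to some such drawn neighbor $w$, and whose bottom side is not lower than that of $w$, is lengthened downward by one unit. All children stay attached directly beneath their parent: when the bottom side of a node moves down by one unit, so do the top sides of its drawn children, and the bottom side of such a child moves down as well if the child has height one. **Lemma.** If $T$ is an orderly spanning tree of the $n$-node plane triangulation $G$, then $\mathrm{draw}(G,T)$ terminates and its output is a 2-visibility drawing of $G$, whose height is at most $n-1$ and whose width equals the number of leaves of $T$. -/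

import Mathlib

/-! ## Plane graphs as rotation systems -/

/-- A graph together with a rotation system: `rot` sends a dart (directed edge) `u → v` to the dart
`u → w` where `w` is the neighbour of `u` that follows `v` in counterclockwise order around `u`. -/
structure RotationSystem (V : Type*) where
  graph : SimpleGraph V
  rot : Equiv.Perm graph.Dart
  rot_fst : ∀ d, (rot d).fst = d.fst
  rot_cyclic : ∀ d e : graph.Dart, d.fst = e.fst → rot.SameCycle d e

namespace RotationSystem

variable {V : Type*} (M : RotationSystem V)

/-- Walking along the boundary of the face on the left of a dart: the dart `u → v` is followed by
`v → w`, where `w` is the neighbour of `v` that precedes `u` in counterclockwise order. -/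
def faceNext : Equiv.Perm M.graph.Dart :=
  (Function.Involutive.toPerm _ SimpleGraph.Dart.symm_involutive).trans M.rot.symm

/-- The faces: the orbits of `faceNext`. -/
def Face : Type _ := Quotient (Equiv.Perm.SameCycle.setoid M.faceNext)

/-- The face on the left of a dart. -/
def leftFace (d : M.graph.Dart) : M.Face :=
  Quotient.mk (Equiv.Perm.SameCycle.setoid M.faceNext) d

end RotationSystem

/-- A connected simple plane graph (with at least one edge): a connected graph with a rotation
system of genus zero (Euler's formula) and a distinguished external face. -/
structure PlaneGraph (V : Type*) extends RotationSystem V where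
  connected : graph.Connected
  euler : (Nat.card V : ℤ) - (Nat.card graph.edgeSet : ℤ) +
    (Nat.card toRotationSystem.Face : ℤ) = 2
  externalFace : toRotationSystem.Face

namespace PlaneGraph

variable {V : Type*} (G : PlaneGraph V)

/-- A node is external if it lies on the contour, the boundary of the external face. -/
def IsExternal (v : V) : Prop :=
  ∃ d : G.graph.Dart, d.fst = v ∧ G.leftFace d = G.externalFace

/-- A plane triangulation: at least three nodes, and every face (the external one included) is
bounded by three edges. -/
structure IsTriangulation : Prop where
  three_le_card : 3 ≤ Nat.card V
  triangular : ∀ d : G.graph.Dart, G.faceNext (G.faceNext (G.faceNext d)) = d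

end PlaneGraph

/-! ## Rooted spanning trees -/

/-- A rooted spanning tree of a graph, given by its root and its parent pointers.  (The parent
pointer of the root has no meaning; it points to the root itself.) -/
structure RootedSpanningTree {V : Type*} (G : SimpleGraph V) where
  root : V
  parent : V → V
  parent_root : parent root = root
  adj_parent : ∀ v, v ≠ root → G.Adj v (parent v)
  reaches_root : ∀ v, ∃ k : ℕ, parent^[k] v = root

namespace RootedSpanningTree

variable {V : Type*} {G : SimpleGraph V} (T : RootedSpanningTree G)

/-- `w` is a child of `v`. -/
def IsChild (w v : V) : Prop := w ≠ T.root ∧ T.parent w = v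

/-- `a` is a (proper) ancestor of `v`. -/
def IsAncestor (a v : V) : Prop := a ≠ v ∧ ∃ k : ℕ, T.parent^[k] v = a

/-- Distinct nodes, neither of which is an ancestor of the other. -/
def Unrelated (u v : V) : Prop := u ≠ v ∧ ¬ T.IsAncestor u v ∧ ¬ T.IsAncestor v u

/-- The number of leaves, that is, of nodes without children. -/
noncomputable def numLeaves : ℕ := Nat.card {v : V // ∀ w, ¬ T.IsChild w v}

end RootedSpanningTree

/-! ## Orderly spanning trees -/

namespace PlaneGraph

variable {V : Type*} (G : PlaneGraph V) (T : RootedSpanningTree G.graph)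

open scoped Classical in
/-- Where the counterclockwise list of the neighbours of `v` starts: at the parent of `v`; for the
root, just after the external face. -/
noncomputable def firstDart (v : V) : Option G.graph.Dart :=
  if h : v ≠ T.root then some ⟨(v, T.parent v), T.adj_parent v h⟩
  else if h : ∃ d : G.graph.Dart, d.fst = v ∧ G.leftFace d = G.externalFace then
    some (G.rot h.choose)
  else none

/-- The neighbours of `v` in counterclockwise order around `v`, from `firstDart` on. -/
noncomputable def ccwNeighbors (v : V) : List V :=
  match G.firstDart T v with
  | none => []
  | some d => (List.iterate G.rot d (Nat.card (G.graph.neighborSet v))).map (fun e => e.snd)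

open scoped Classical in
/-- The children of `v` in `T`, in counterclockwise order around `v`. -/
noncomputable def ccwChildren (v : V) : List V :=
  (G.ccwNeighbors T v).filter (fun w => decide (T.IsChild w v))

/-- The counterclockwise preordering of the nodes in the subtree of `T` rooted at `v`, down to
the given number of levels. -/
noncomputable def preorderFrom : ℕ → V → List V
  | 0, _ => []
  | k + 1, v => v :: (G.ccwChildren T v).flatMap (preorderFrom k)

/-- The counterclockwise preordering `v₁, v₂, …, vₙ` of the nodes in `T` (a tree with `n` nodes
has at most `n` levels). -/
noncomputable def preorder : List V := G.preorderFrom T (Nat.card V) T.root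

open scoped Classical in
/-- The position of a node in the counterclockwise preordering of `T`. -/
noncomputable def index (v : V) : ℕ := (G.preorder T).idxOf v

/-- `v` is orderly: its neighbours form, in counterclockwise order around `v`, the four (possibly
empty) blocks: parent; unrelated neighbours that come before `v` in the preordering; children;
unrelated neighbours that come after `v` in the preordering. -/
def IsOrderlyAt (v : V) : Prop :=
  ∃ B₁ B₂ B₃ B₄ : List V, G.ccwNeighbors T v = B₁ ++ B₂ ++ B₃ ++ B₄ ∧
    (∀ w, w ∈ B₁ ↔ T.IsChild v w) ∧
    (∀ w, w ∈ B₂ ↔ G.graph.Adj v w ∧ T.Unrelated v w ∧ G.index T w < G.index T v) ∧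
    (∀ w, w ∈ B₃ ↔ T.IsChild w v) ∧
    (∀ w, w ∈ B₄ ↔ G.graph.Adj v w ∧ T.Unrelated v w ∧ G.index T v < G.index T w)

/-- `T` is an orderly spanning tree of `G`. -/
structure IsOrderlySpanningTree : Prop where
  root_external : G.IsExternal T.root
  orderly : ∀ v, G.IsOrderlyAt T v

end PlaneGraph

/-! ## 2-visibility drawings -/

/-- An axis-parallel rectangle with integer corner coordinates; the `y`-axis points downward. -/
@[ext]
structure Rect where
  left : ℤ
  right : ℤ
  top : ℤ
  bottom : ℤ

namespace Rect

/-- The closed rectangle as a set of points. -/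
def region (r : Rect) : Set (ℝ × ℝ) :=
  Set.Icc (r.left : ℝ) r.right ×ˢ Set.Icc (r.top : ℝ) r.bottom

end Rect

section Visibility

variable {V : Type*}

/-- Some horizontal segment leads from the (relative interior of the) right side of the rectangle
of `u` to that of the left side of the rectangle of `v`, and meets no rectangle of other nodes
in `S`. -/
def SeesRight (S : Set V) (R : V → Rect) (u v : V) : Prop :=
  (R u).right ≤ (R v).left ∧ ∃ y : ℝ,
    y ∈ Set.Ioo ((R u).top : ℝ) (R u).bottom ∧ y ∈ Set.Ioo ((R v).top : ℝ) (R v).bottom ∧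
    ∀ k ∈ S, k ≠ u → k ≠ v →
      ∀ x ∈ Set.Icc ((R u).right : ℝ) (R v).left, (x, y) ∉ (R k).region

/-- Some vertical segment leads from the (relative interior of the) bottom side of the rectangle
of `u` to that of the top side of the rectangle of `v`, and meets no rectangle of other nodes
in `S`. -/
def SeesDown (S : Set V) (R : V → Rect) (u v : V) : Prop :=
  (R u).bottom ≤ (R v).top ∧ ∃ x : ℝ,
    x ∈ Set.Ioo ((R u).left : ℝ) (R u).right ∧ x ∈ Set.Ioo ((R v).left : ℝ) (R v).right ∧
    ∀ k ∈ S, k ≠ u → k ≠ v →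
      ∀ y ∈ Set.Icc ((R u).bottom : ℝ) (R v).top, (x, y) ∉ (R k).region

/-- `u` and `v` are horizontally visible to each other among the rectangles of nodes in `S`. -/
def HVisible (S : Set V) (R : V → Rect) (u v : V) : Prop := SeesRight S R u v ∨ SeesRight S R v u

/-- `u` and `v` are vertically visible to each other among the rectangles of nodes in `S`. -/
def VVisible (S : Set V) (R : V → Rect) (u v : V) : Prop := SeesDown S R u v ∨ SeesDown S R v u

/-- A 2-visibility drawing of a graph: non-overlapping rectangles, none smaller than `1 × 1`, such
that adjacent nodes are visible to each other horizontally or vertically. -/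
structure IsTwoVisibilityDrawing (G : SimpleGraph V) (R : V → Rect) : Prop where
  one_le_width : ∀ v, (R v).left + 1 ≤ (R v).right
  one_le_height : ∀ v, (R v).top + 1 ≤ (R v).bottom
  nonoverlapping : ∀ u v, u ≠ v → Disjoint (interior (R u).region) (interior (R v).region)
  visible : ∀ u v, G.Adj u v → HVisible Set.univ R u v ∨ VVisible Set.univ R u v

/-- The width of the bounding box of a drawing with finitely many rectangles. -/
noncomputable def drawingWidth (R : V → Rect) : ℤ := (⨆ v, (R v).right) - ⨅ v, (R v).left

/-- The height of the bounding box of a drawing with finitely many rectangles. -/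
noncomputable def drawingHeight (R : V → Rect) : ℤ := (⨆ v, (R v).bottom) - ⨅ v, (R v).top

end Visibility

/-! ## The algorithm `draw` -/

/-- The intermediate drawing: the nodes drawn so far, and three sides of their rectangles.  The
top side needs no entry, because every node stays attached beneath its parent. -/
structure DrawState (V : Type*) where
  drawn : Set V
  left : V → ℤ
  right : V → ℤ
  bottom : V → ℤ

namespace PlaneGraph

variable {V : Type*} (G : PlaneGraph V) (T : RootedSpanningTree G.graph)

/-- The empty drawing. -/
def emptyState : DrawState V := ⟨∅, fun _ => 0, fun _ => 0, fun _ => 0⟩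

open scoped Classical in
/-- The top side of `v`: the bottom side of its parent (and `0` for the root). -/
noncomputable def topSide (D : DrawState V) (v : V) : ℤ :=
  if v = T.root then 0 else D.bottom (T.parent v)

/-- The rectangle of `v` in the intermediate drawing. -/
noncomputable def rect (D : DrawState V) (v : V) : Rect :=
  ⟨D.left v, D.right v, G.topSide T D v, D.bottom v⟩

open scoped Classical in
/-- Step 1 of the iteration for `v`: if `v` is neither the root nor the first child of its parent,
then lengthen each ancestor of `v` to the right by one unit. -/
noncomputable def drawStep1 (v : V) (D : DrawState V) : DrawState V :=
  if v ≠ T.root ∧ (G.ccwChildren T (T.parent v)).head? ≠ some v then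
    { D with right := fun a => if T.IsAncestor a v then D.right a + 1 else D.right a }
  else D

open scoped Classical in
/-- Step 2 of the iteration for `v`: draw `v` as a unit square beneath its parent, aligned with
the right side of its parent. -/
noncomputable def drawStep2 (v : V) (D : DrawState V) : DrawState V :=
  let r : ℤ := if v = T.root then 1 else D.right (T.parent v)
  { drawn := insert v D.drawn
    left := Function.update D.left v (r - 1)
    right := Function.update D.right v r
    bottom := Function.update D.bottom v (G.topSide T D v + 1) }

/-- The pairs that Step 3 makes horizontally visible: drawn nodes joined by an edge of `G` that is
not an edge of `T`. -/
def MustSee (D : DrawState V) (u w : V) : Prop :=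
  u ∈ D.drawn ∧ w ∈ D.drawn ∧ G.graph.Adj u w ∧ ¬ T.IsChild u w ∧ ¬ T.IsChild w u

/-- `u` has to be lengthened: it has yet to become horizontally visible to some `w`, and does not
reach further down than `w`. -/
def IsTooShort (D : DrawState V) (u : V) : Prop :=
  ∃ w, G.MustSee T D u w ∧ ¬ HVisible D.drawn (G.rect T D) u w ∧ D.bottom u ≤ D.bottom w

/-- Lengthening `u` downward by one unit moves the bottom side of `x` downward by one unit: `x` is
`u` itself, or a descendant of `u` such that `x` and all nodes between `u` and `x` in the tree
have height one and hence give way.  (The top sides of the children of a moved bottom side move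
along with it.) -/
def MovesWith (D : DrawState V) (u x : V) : Prop :=
  x = u ∨ (T.IsAncestor u x ∧ ∀ z, (z = x ∨ T.IsAncestor z x) → T.IsAncestor u z →
    D.bottom z = G.topSide T D z + 1)

open scoped Classical in
/-- Lengthen each node that is too short downward by one unit. -/
noncomputable def lengthen (D : DrawState V) : DrawState V :=
  { D with bottom := fun x =>
      if x ∈ D.drawn ∧ ∃ u, G.IsTooShort T D u ∧ G.MovesWith T D u x then D.bottom x + 1
      else D.bottom x }

/-- All drawn nodes that must see each other do so. -/
def IsSettled (D : DrawState V) : Prop :=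
  ∀ u w, G.MustSee T D u w → HVisible D.drawn (G.rect T D) u w

open scoped Classical in
/-- Step 3: lengthen nodes downward, unit by unit and only where necessary, until all drawn
nodes that must see each other do so; `none` if this loop does not terminate. -/
noncomputable def drawStep3 (D : DrawState V) : Option (DrawState V) :=
  if h : ∃ k : ℕ, G.IsSettled T ((G.lengthen T)^[k] D) then
    some ((G.lengthen T)^[Nat.find h] D)
  else none

/-- One iteration of the algorithm. -/
noncomputable def drawIteration (D : DrawState V) (v : V) : Option (DrawState V) :=
  G.drawStep3 T (G.drawStep2 T v (G.drawStep1 T v D))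

/-- The algorithm `draw`: one iteration for each node, in the counterclockwise preordering of `T`;
`none` if some iteration does not terminate. -/
noncomputable def draw : Option (V → Rect) :=
  ((G.preorder T).foldlM (G.drawIteration T) (emptyState : DrawState V)).map (G.rect T)

end PlaneGraph

/-! The substance is that the loop of Step 3 stops and that no bottom side gets deeper than n - 1.
Visibility along non-tree edges is then the exit condition of the loop, and a child touches the
bottom side of its parent.

Both facts follow from an integer level `L` between 1 and n - 1 (`IsLevel`) and the invariant that
each bottom side is at most the level of its node. Levels increase strictly from a parent to its
child, from the parent of one end of an edge between unrelated nodes to the other end, and from any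
node between the ends of such an edge, unrelated to both, to either end. If `u` has reached its
level and does not reach further down than its partner `w`, then both occupy the unit row just above
the bottom side of `u`, and everything between them has ended above that row; so they see each
other. Hence a node that is too short lies strictly above its level, the children it pushes do too,
and the total distance to the levels decreases (`bottom_lt_of_isTooShort`, `exists_isSettled`).

The levels come from the triangular faces. Two consecutive neighbours of a node form a face with it,
and comparing the orderly blocks at the corners determines how the list of earlier unrelated
neighbours begins and continues (`first_earlier`, `consecutive_earlier`). Place the nodes on a line
in preorder, each directly to the left of its last earlier neighbour, or to the right of everything
if it has none. Induction gives all required inequalities between the positions (`IsRank.aux`). The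
level of a node is one plus the number of nodes to its left, where the last node of the preorder is
not counted: no inequality needs it as the smaller side, and it is not the unique rightmost point.
This gives n - 1 instead of n.

For the width, the root spans the drawing and is widened once for each child that is not a first
child; the leaves outnumber these children by one. -/

/-! ## Ancestors in a rooted spanning tree -/

namespace RootedSpanningTree

variable {V : Type*} {G : SimpleGraph V} (T : RootedSpanningTree G)

/-- `a` is `v` or an ancestor of `v`. -/
def Above (a v : V) : Prop := ∃ k : ℕ, T.parent^[k] v = a

theorem Above.refl (v : V) : T.Above v v := ⟨0, rfl⟩

variable {T}

theorem Above.trans {a b c : V} (h₁ : T.Above a b) (h₂ : T.Above b c) : T.Above a c := by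
  obtain ⟨k, rfl⟩ := h₁
  obtain ⟨l, rfl⟩ := h₂
  exact ⟨k + l, Function.iterate_add_apply _ _ _ _⟩

theorem above_parent (v : V) : T.Above (T.parent v) v := ⟨1, rfl⟩

theorem above_iff_eq_or {a v : V} : T.Above a v ↔ a = v ∨ T.Above a (T.parent v) := by
  constructor
  · rintro ⟨k, hk⟩
    cases k with
    | zero => exact Or.inl hk.symm
    | succ k => exact Or.inr ⟨k, by rwa [Function.iterate_succ_apply] at hk⟩
  · rintro (rfl | h)
    · exact Above.refl T a
    · exact h.trans (above_parent v)

theorem root_above (v : V) : T.Above T.root v := T.reaches_root v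

theorem Above.total {a b v : V} (ha : T.Above a v) (hb : T.Above b v) :
    T.Above a b ∨ T.Above b a := by
  obtain ⟨k, rfl⟩ := ha
  obtain ⟨l, rfl⟩ := hb
  rcases le_total k l with h | h
  · exact Or.inr ⟨l - k, by rw [← Function.iterate_add_apply, Nat.sub_add_cancel h]⟩
  · exact Or.inl ⟨k - l, by rw [← Function.iterate_add_apply, Nat.sub_add_cancel h]⟩

variable (T) in
open scoped Classical in
/-- The distance from the root. -/
noncomputable def depth (v : V) : ℕ := Nat.find (T.reaches_root v)

theorem depth_root : T.depth T.root = 0 := by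
  classical
  exact (Nat.find_eq_zero _).2 rfl

theorem depth_parent {v : V} (hv : v ≠ T.root) : T.depth v = T.depth (T.parent v) + 1 := by
  classical
  unfold depth
  apply le_antisymm
  · refine Nat.find_min' _ ?_
    rw [Function.iterate_succ_apply]
    exact Nat.find_spec (T.reaches_root (T.parent v))
  · have h := Nat.find_spec (T.reaches_root v)
    rcases hk : Nat.find (T.reaches_root v) with _ | k
    · rw [hk] at h; exact absurd h hv
    · rw [hk, Function.iterate_succ_apply] at h
      exact Nat.succ_le_succ (Nat.find_min' _ h)

theorem depth_parent_le (v : V) : T.depth (T.parent v) ≤ T.depth v := by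
  by_cases hv : v = T.root
  · subst hv; rw [T.parent_root]
  · rw [depth_parent hv]; omega

theorem Above.depth_le {a v : V} (h : T.Above a v) : T.depth a ≤ T.depth v := by
  obtain ⟨k, rfl⟩ := h
  induction k with
  | zero => exact le_rfl
  | succ k ih => rw [Function.iterate_succ_apply']; exact (depth_parent_le _).trans ih

theorem parent_ne {v : V} (hv : v ≠ T.root) : T.parent v ≠ v := fun h => by
  have := depth_parent hv
  rw [h] at this
  omega

theorem Above.antisymm {a b : V} (h₁ : T.Above a b) (h₂ : T.Above b a) : a = b := by
  rcases above_iff_eq_or.1 h₁ with h | h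
  · exact h
  · by_cases hb : b = T.root
    · subst hb
      rw [T.parent_root] at h
      obtain ⟨k, hk⟩ := h
      rw [← hk, Function.iterate_fixed T.parent_root]
    · have := depth_parent hb
      have := h.depth_le
      have := h₂.depth_le
      omega

theorem Above.eq_root {a : V} (h : T.Above a T.root) : a = T.root :=
  h.antisymm (root_above a)

theorem IsAncestor.above {a v : V} (h : T.IsAncestor a v) : T.Above a v := h.2

theorem IsAncestor.ne_root {a v : V} (h : T.IsAncestor a v) : v ≠ T.root := by
  rintro rfl
  exact h.1 h.above.eq_root

theorem isAncestor_iff_parent {a v : V} :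
    T.IsAncestor a v ↔ v ≠ T.root ∧ T.Above a (T.parent v) := by
  constructor
  · intro h
    exact ⟨h.ne_root, (above_iff_eq_or.1 h.above).resolve_left h.1⟩
  · rintro ⟨hv, h⟩
    refine ⟨?_, h.trans (above_parent v)⟩
    rintro rfl
    exact parent_ne hv ((above_parent _).antisymm h)

theorem isAncestor_parent {v : V} (hv : v ≠ T.root) : T.IsAncestor (T.parent v) v :=
  isAncestor_iff_parent.2 ⟨hv, Above.refl _ _⟩

theorem IsChild.isAncestor {c v : V} (h : T.IsChild c v) : T.IsAncestor v c := by
  obtain ⟨h₁, rfl⟩ := h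
  exact isAncestor_parent h₁

theorem unrelated_iff {u v : V} : T.Unrelated u v ↔ ¬ T.Above u v ∧ ¬ T.Above v u := by
  constructor
  · rintro ⟨h, h₁, h₂⟩
    exact ⟨fun h' => h₁ ⟨h, h'⟩, fun h' => h₂ ⟨h.symm, h'⟩⟩
  · rintro ⟨h₁, h₂⟩
    refine ⟨?_, fun h => h₁ h.above, fun h => h₂ h.above⟩
    rintro rfl
    exact h₁ (Above.refl _ _)

theorem Unrelated.symm {u v : V} (h : T.Unrelated u v) : T.Unrelated v u :=
  ⟨h.1.symm, h.2.2, h.2.1⟩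

theorem Unrelated.ne_root_left {u v : V} (h : T.Unrelated u v) : u ≠ T.root := by
  rintro rfl
  exact (unrelated_iff.1 h).1 (root_above v)

theorem Unrelated.ne_root_right {u v : V} (h : T.Unrelated u v) : v ≠ T.root :=
  h.symm.ne_root_left

theorem Above.exists_child {a v : V} (h : T.Above a v) (hne : v ≠ a) :
    ∃ c, T.IsChild c a ∧ T.Above c v := by
  obtain ⟨k, hk⟩ := h
  induction k generalizing v with
  | zero => exact absurd hk hne
  | succ k ih =>
    rw [Function.iterate_succ_apply] at hk
    by_cases hp : T.parent v = a
    · refine ⟨v, ⟨?_, hp⟩, Above.refl _ _⟩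
      rintro rfl
      rw [T.parent_root] at hp
      exact hne hp
    · obtain ⟨c, hc, hcv⟩ := ih hp hk
      exact ⟨c, hc, hcv.trans (above_parent v)⟩

theorem above_iff_exists_child {a v : V} :
    T.Above a v ↔ v = a ∨ ∃ c, T.IsChild c a ∧ T.Above c v := by
  constructor
  · intro h
    by_cases hv : v = a
    · exact Or.inl hv
    · exact Or.inr (h.exists_child hv)
  · rintro (rfl | ⟨c, hc, hcv⟩)
    · exact Above.refl _ _
    · exact hc.isAncestor.above.trans hcv

theorem IsChild.not_above {a b p : V} (ha : T.IsChild a p) (hb : T.IsChild b p) (h : a ≠ b) :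
    ¬ T.Above a b := by
  intro hab
  have h₁ := (above_iff_eq_or.1 hab).resolve_left h
  rw [hb.2] at h₁
  exact ha.isAncestor.1 (ha.isAncestor.above.antisymm h₁)

/-- The ancestors of `v` realise every depth from 0 to that of `v`, which takes one node per depth.
This makes the number of levels allotted to `preorder` sufficient. -/
theorem depth_lt_card [Finite V] (v : V) : T.depth v < Nat.card V := by
  have h : ∀ n, ∀ v, T.depth v = n → ∀ m ≤ n, m ∈ Set.range T.depth := by
    intro n
    induction n with
    | zero => rintro v hv m hm; exact ⟨v, by omega⟩
    | succ n ih =>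
      intro v hv m hm
      rcases Nat.lt_or_ge m (n + 1) with h | h
      · have hr : v ≠ T.root := by rintro rfl; rw [depth_root] at hv; omega
        have := depth_parent hr
        exact ih (T.parent v) (by omega) m (by omega)
      · exact ⟨v, by omega⟩
  have h₁ : Set.Iic (T.depth v) ⊆ Set.range T.depth := fun m hm => h _ v rfl m hm
  have h₂ := Set.ncard_le_ncard h₁ (Set.finite_range _)
  have h₃ : (Set.range T.depth).ncard ≤ Nat.card V := by
    rw [← Set.image_univ, ← Set.ncard_univ]
    exact Set.ncard_image_le (Set.toFinite _)
  have h₄ : (Set.Iic (T.depth v)).ncard = T.depth v + 1 := by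
    rw [← Finset.coe_Iic, Set.ncard_coe_finset, Nat.card_Iic]
  omega

end RootedSpanningTree

/-! ## Positions in lists -/

namespace List

variable {α : Type*} [DecidableEq α]

theorem length_le_idxOf_of_mem_append {s m t : List α} {x : α} (h : (s ++ (m ++ t)).Nodup)
    (hx : x ∈ m ++ t) : s.length ≤ (s ++ (m ++ t)).idxOf x := by
  have hs : x ∉ s := fun hs => (List.nodup_append.1 h).2.2 x hs x hx rfl
  rw [List.idxOf_append_of_notMem hs]
  omega

theorem idxOf_lt_of_mem_append {s m t : List α} {x : α} (hx : x ∈ s ++ m) :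
    (s ++ (m ++ t)).idxOf x < s.length + m.length := by
  rw [← List.append_assoc, List.idxOf_append_of_mem hx, ← List.length_append]
  exact List.idxOf_lt_length_iff.2 hx

theorem mem_of_idxOf_mem {s m t : List α} {x : α}
    (h₁ : s.length ≤ (s ++ (m ++ t)).idxOf x)
    (h₂ : (s ++ (m ++ t)).idxOf x < s.length + m.length) : x ∈ m := by
  by_cases hs : x ∈ s
  · rw [List.idxOf_append_of_mem hs] at h₁
    have := List.idxOf_lt_length_iff.2 hs
    omega
  · rw [List.idxOf_append_of_notMem hs] at h₂
    by_contra hm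
    rw [List.idxOf_append_of_notMem hm] at h₂
    omega

end List

/-! ## The counterclockwise preordering -/

namespace PlaneGraph

open RootedSpanningTree

variable {V : Type*} {G : PlaneGraph V} {T : RootedSpanningTree G.graph}

/-- The list of children of each node is complete and free of repetitions. -/
def HasCcwChildren (G : PlaneGraph V) (T : RootedSpanningTree G.graph) : Prop :=
  ∀ v, (G.ccwChildren T v).Nodup ∧ ∀ w, w ∈ G.ccwChildren T v ↔ T.IsChild w v

/-- The hypothesis `hk` says that the recursion budget `k` reaches below the deepest node; it passes
to the children, where the depth gains the unit that `k` loses. -/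
theorem mem_preorderFrom [Finite V] (hC : G.HasCcwChildren T) (k : ℕ) (v x : V)
    (hk : Nat.card V ≤ T.depth v + k) : x ∈ G.preorderFrom T k v ↔ T.Above v x := by
  induction k generalizing v with
  | zero => have := T.depth_lt_card v; omega
  | succ k ih =>
    rw [preorderFrom, List.mem_cons, List.mem_flatMap, above_iff_exists_child]
    refine or_congr Iff.rfl (exists_congr fun c => ?_)
    rw [(hC v).2]
    refine and_congr_right fun hc => ih c ?_
    have := depth_parent hc.1
    rw [hc.2] at this
    omega

theorem nodup_preorderFrom [Finite V] (hC : G.HasCcwChildren T) (k : ℕ) (v : V)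
    (hk : Nat.card V ≤ T.depth v + k) : (G.preorderFrom T k v).Nodup := by
  induction k generalizing v with
  | zero => exact List.nodup_nil
  | succ k ih =>
    have hd : ∀ c, T.IsChild c v → Nat.card V ≤ T.depth c + k := by
      intro c hc
      have := depth_parent hc.1
      rw [hc.2] at this
      omega
    rw [preorderFrom, List.nodup_cons, List.nodup_flatMap]
    refine ⟨?_, fun c hc => ih c (hd c (((hC v).2 c).1 hc)), ?_⟩
    · rw [List.mem_flatMap]
      rintro ⟨c, hc, hv⟩
      have hc' := ((hC v).2 c).1 hc
      rw [mem_preorderFrom hC k c v (hd c hc')] at hv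
      exact hc'.isAncestor.1 (hc'.isAncestor.above.antisymm hv)
    · refine (hC v).1.imp_of_mem ?_
      intro a b ha hb hab x hxa hxb
      have ha' := ((hC v).2 a).1 ha
      have hb' := ((hC v).2 b).1 hb
      rw [mem_preorderFrom hC k a x (hd a ha')] at hxa
      rw [mem_preorderFrom hC k b x (hd b hb')] at hxb
      rcases hxa.total hxb with h | h
      · exact ha'.not_above hb' hab h
      · exact hb'.not_above ha' hab.symm h

theorem nodup_preorder [Finite V] (hC : G.HasCcwChildren T) : (G.preorder T).Nodup :=
  nodup_preorderFrom hC _ _ (by omega)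

theorem mem_preorder [Finite V] (hC : G.HasCcwChildren T) (v : V) : v ∈ G.preorder T :=
  (mem_preorderFrom hC _ _ _ (by omega)).2 (root_above v)

/-- By induction on the depth, the segment of the parent is cut at `v`, so each subtree is a
contiguous segment of the preorder. -/
theorem exists_preorder_eq [Finite V] (hC : G.HasCcwChildren T) (v : V) :
    ∃ s t k, G.preorder T = s ++ (G.preorderFrom T (k + 1) v ++ t) ∧
      Nat.card V ≤ T.depth v + (k + 1) := by
  induction hn : T.depth v generalizing v with
  | zero =>
    have hv : v = T.root := by
      by_contra hv
      rw [depth_parent hv] at hn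
      omega
    subst hv
    have := T.depth_lt_card T.root
    refine ⟨[], [], Nat.card V - 1, ?_, by omega⟩
    rw [preorder, Nat.sub_add_cancel (by omega)]
    simp
  | succ n ih =>
    have hv : v ≠ T.root := by
      rintro rfl
      rw [depth_root] at hn
      omega
    have hd := depth_parent hv
    obtain ⟨s, t, k, h, hk⟩ := ih (T.parent v) (by omega)
    obtain ⟨c₁, c₂, hc⟩ := List.append_of_mem (((hC (T.parent v)).2 v).2 ⟨hv, rfl⟩)
    have hlt := T.depth_lt_card v
    obtain ⟨k, rfl⟩ : ∃ l, k = l + 1 := ⟨k - 1, by omega⟩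
    refine ⟨s ++ T.parent v :: c₁.flatMap (G.preorderFrom T (k + 1)),
      c₂.flatMap (G.preorderFrom T (k + 1)) ++ t, k, ?_, by omega⟩
    rw [h, preorderFrom, hc]
    simp

theorem index_injective [Finite V] (hC : G.HasCcwChildren T) :
    Function.Injective (G.index T) := by
  classical
  intro a b h
  exact (List.idxOf_inj (mem_preorder hC a)).1 h

/-- Contiguity of subtrees turns ancestry into interval arithmetic on indices; `m` is the size of
the subtree. -/
theorem above_iff_index [Finite V] (hC : G.HasCcwChildren T) (a : V) :
    ∃ m, 0 < m ∧ ∀ x, T.Above a x ↔ G.index T a ≤ G.index T x ∧ G.index T x < G.index T a + m := by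
  classical
  obtain ⟨s, t, k, h, hk⟩ := exists_preorder_eq hC a
  have hnd := nodup_preorder hC
  rw [h] at hnd
  have hidx : ∀ x, G.index T x = (s ++ (G.preorderFrom T (k + 1) a ++ t)).idxOf x := by
    intro x
    rw [index, h]
  have ha : G.index T a = s.length := by
    rw [hidx, List.idxOf_append_of_notMem]
    · simp [preorderFrom]
    · exact fun hs => (List.nodup_append.1 hnd).2.2 a hs a (by simp [preorderFrom]) rfl
  refine ⟨(G.preorderFrom T (k + 1) a).length, by simp [preorderFrom], fun x => ?_⟩
  rw [← mem_preorderFrom hC (k + 1) a x (by omega), ha, hidx]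
  constructor
  · intro hx
    exact ⟨List.length_le_idxOf_of_mem_append hnd (List.mem_append_left _ hx),
      List.idxOf_lt_of_mem_append (List.mem_append_right _ hx)⟩
  · rintro ⟨h₁, h₂⟩
    exact List.mem_of_idxOf_mem h₁ h₂

theorem index_le_of_above [Finite V] (hC : G.HasCcwChildren T) {a x : V} (h : T.Above a x) :
    G.index T a ≤ G.index T x := by
  obtain ⟨m, -, hm⟩ := above_iff_index hC a
  exact ((hm x).1 h).1

theorem index_lt_of_isAncestor [Finite V] (hC : G.HasCcwChildren T) {a x : V}
    (h : T.IsAncestor a x) : G.index T a < G.index T x :=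
  lt_of_le_of_ne (index_le_of_above hC h.above) fun he => h.1 (index_injective hC he)

theorem index_parent_lt [Finite V] (hC : G.HasCcwChildren T) {v : V} (hv : v ≠ T.root) :
    G.index T (T.parent v) < G.index T v :=
  index_lt_of_isAncestor hC (isAncestor_parent hv)

theorem above_of_index_le [Finite V] (hC : G.HasCcwChildren T) {a x y : V} (h : T.Above a y)
    (hax : G.index T a ≤ G.index T x) (hxy : G.index T x ≤ G.index T y) : T.Above a x := by
  obtain ⟨m, -, hm⟩ := above_iff_index hC a
  have := (hm y).1 h
  exact (hm x).2 ⟨hax, by omega⟩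

theorem index_lt_of_ccwChildren_eq [Finite V] (hC : G.HasCcwChildren T) {p a b : V}
    {l₁ l₂ : List V} (h : G.ccwChildren T p = l₁ ++ b :: l₂) (ha : a ∈ l₁) :
    G.index T a < G.index T b := by
  classical
  obtain ⟨s, t, k, hp, hk⟩ := exists_preorder_eq hC p
  have hlt := T.depth_lt_card
  have hb : T.IsChild b p := ((hC p).2 b).1 (by rw [h]; simp)
  have ha' : T.IsChild a p := ((hC p).2 a).1 (by rw [h]; simp [ha])
  have hd : ∀ c, T.IsChild c p → Nat.card V ≤ T.depth c + k := by
    intro c hc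
    have := depth_parent hc.1
    rw [hc.2] at this
    omega
  have hnd := nodup_preorder hC
  have heq : G.preorder T = (s ++ p :: l₁.flatMap (G.preorderFrom T k)) ++
      (G.preorderFrom T k b ++ (l₂.flatMap (G.preorderFrom T k) ++ t)) := by
    rw [hp, preorderFrom, h]
    simp
  have hma : a ∈ l₁.flatMap (G.preorderFrom T k) :=
    List.mem_flatMap.2 ⟨a, ha, (mem_preorderFrom hC k a a (hd a ha')).2 (Above.refl _ _)⟩
  have hmb : b ∈ G.preorderFrom T k b := (mem_preorderFrom hC k b b (hd b hb)).2 (Above.refl _ _)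
  rw [index, index, heq]
  rw [heq] at hnd
  refine lt_of_lt_of_le ?_ (List.length_le_idxOf_of_mem_append hnd (List.mem_append_left _ hmb))
  have hma' : a ∈ s ++ p :: l₁.flatMap (G.preorderFrom T k) := by simp [hma]
  rw [List.idxOf_append_of_mem hma']
  exact List.idxOf_lt_length_iff.2 hma'

/-- The nodes between two consecutive siblings in the preordering are below the first one. -/
theorem above_of_index_between_siblings [Finite V] (hC : G.HasCcwChildren T) {p a b x : V}
    {l₁ l₂ : List V} (h : G.ccwChildren T p = l₁ ++ a :: b :: l₂)
    (hax : G.index T a ≤ G.index T x) (hxb : G.index T x < G.index T b) : T.Above a x := by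
  have hb : T.IsChild b p := ((hC p).2 b).1 (by rw [h]; simp)
  have ha : T.IsChild a p := ((hC p).2 a).1 (by rw [h]; simp)
  have hpx : T.Above p x := above_of_index_le hC hb.isAncestor.above
    ((index_lt_of_isAncestor hC ha.isAncestor).le.trans hax) hxb.le
  have hne : x ≠ p := by
    rintro rfl
    have := index_lt_of_isAncestor hC ha.isAncestor
    omega
  obtain ⟨c, hc, hcx⟩ := hpx.exists_child hne
  have hcx' := index_le_of_above hC hcx
  have hmem := ((hC p).2 c).2 hc
  rw [h, List.mem_append, List.mem_cons, List.mem_cons] at hmem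
  rcases hmem with hm | rfl | rfl | hm
  · have hca : G.index T c < G.index T a := index_lt_of_ccwChildren_eq hC h hm
    have hne : c ≠ a := by rintro rfl; omega
    exact absurd (above_of_index_le hC hcx hca.le hax) (hc.not_above ha hne)
  · exact hcx
  · omega
  · obtain ⟨m₁, m₂, rfl⟩ := List.append_of_mem hm
    have : G.index T b < G.index T c := index_lt_of_ccwChildren_eq hC
      (l₁ := l₁ ++ a :: b :: m₁) (l₂ := m₂) (by rw [h]; simp) (by simp)
    omega

/-- Below `p`, only the last child and the nodes below it come after the last child. -/
theorem above_last_child [Finite V] (hC : G.HasCcwChildren T) {p a x : V} {l : List V}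
    (h : G.ccwChildren T p = l ++ [a]) (hpx : T.Above p x) (hax : G.index T a < G.index T x) :
    T.Above a x := by
  have ha : T.IsChild a p := ((hC p).2 a).1 (by rw [h]; simp)
  have hne : x ≠ p := by
    rintro rfl
    have := index_lt_of_isAncestor hC ha.isAncestor
    omega
  obtain ⟨c, hc, hcx⟩ := hpx.exists_child hne
  have hmem := ((hC p).2 c).2 hc
  rw [h, List.mem_append, List.mem_singleton] at hmem
  rcases hmem with hm | rfl
  · have hca : G.index T c < G.index T a := index_lt_of_ccwChildren_eq hC h hm
    have hne : c ≠ a := by rintro rfl; omega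
    exact absurd (above_of_index_le hC hcx hca.le hax.le) (hc.not_above ha hne)
  · exact hcx

/-- Nothing lies between a node and its first child in the preordering. -/
theorem index_le_of_lt_first_child [Finite V] (hC : G.HasCcwChildren T) {p a x : V} {l : List V}
    (h : G.ccwChildren T p = a :: l) (hxa : G.index T x < G.index T a) :
    G.index T x ≤ G.index T p := by
  have ha : T.IsChild a p := ((hC p).2 a).1 (by rw [h]; simp)
  by_contra! hpx
  have hpx' : T.Above p x := above_of_index_le hC ha.isAncestor.above hpx.le hxa.le
  obtain ⟨c, hc, hcx⟩ := hpx'.exists_child (by rintro rfl; omega)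
  have hcx' := index_le_of_above hC hcx
  have hmem := ((hC p).2 c).2 hc
  rw [h, List.mem_cons] at hmem
  rcases hmem with rfl | hm
  · omega
  · obtain ⟨m₁, m₂, rfl⟩ := List.append_of_mem hm
    have : G.index T a < G.index T c := index_lt_of_ccwChildren_eq hC
      (l₁ := a :: m₁) (l₂ := m₂) (by rw [h]; simp) (by simp)
    omega

end PlaneGraph

/-! ## Neighbours in counterclockwise order -/

namespace PlaneGraph

open RootedSpanningTree

variable {V : Type*} {G : PlaneGraph V} {T : RootedSpanningTree G.graph}

/-- `b` is the neighbour of `u` that follows `a` in counterclockwise order. -/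
def Next (G : PlaneGraph V) (u a b : V) : Prop :=
  ∃ (ha : G.graph.Adj u a) (hb : G.graph.Adj u b), G.rot ⟨(u, a), ha⟩ = ⟨(u, b), hb⟩

theorem Next.left_unique {u a a' b : V} (h : G.Next u a b) (h' : G.Next u a' b) : a = a' := by
  obtain ⟨ha, hb, h⟩ := h
  obtain ⟨ha', hb', h'⟩ := h'
  have := G.rot.injective (h.trans h'.symm)
  simpa using congrArg (fun d => d.snd) this

theorem next_rot (d : G.graph.Dart) : G.Next d.fst d.snd (G.rot d).snd := by
  have h := (G.rot d).adj
  rw [G.rot_fst] at h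
  exact ⟨d.adj, h, SimpleGraph.Dart.ext _ _ (Prod.ext (G.rot_fst d) rfl)⟩

/-- If `b` follows `a` around `u`, then the face walk goes from `b → u` to `u → a`; having length
three, it must close up through `a → b`. Each corner of this face yields one consecutive pair. -/
theorem Next.triangle (hG : G.IsTriangulation) {u a b : V} (h : G.Next u a b) :
    G.graph.Adj a b ∧ G.Next a b u ∧ G.Next b u a := by
  obtain ⟨ha, hb, h⟩ := h
  have key := hG.triangular ⟨(b, u), hb.symm⟩
  have h₁ : G.faceNext ⟨(b, u), hb.symm⟩ = ⟨(u, a), ha⟩ := by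
    change G.rot.symm ⟨(u, b), _⟩ = _
    rw [← h, Equiv.symm_apply_apply]
  rw [h₁] at key
  obtain ⟨x, hx⟩ : ∃ x, x = G.faceNext ⟨(u, a), ha⟩ := ⟨_, rfl⟩
  rw [← hx] at key
  have h₂ : G.rot x = ⟨(a, u), ha.symm⟩ := by
    rw [hx]
    change G.rot (G.rot.symm ⟨(a, u), _⟩) = _
    rw [Equiv.apply_symm_apply]
  have h₃ : x.symm = G.rot ⟨(b, u), hb.symm⟩ := by
    rw [← key]
    change _ = G.rot (G.rot.symm x.symm)
    rw [Equiv.apply_symm_apply]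
  have hf : x.fst = a := by
    rw [← G.rot_fst, h₂]
  have hs : x.snd = b := by
    have : x.symm.fst = b := by rw [h₃, G.rot_fst]
    exact this
  obtain ⟨⟨x₁, x₂⟩, hadj⟩ := x
  obtain rfl : x₁ = a := hf
  obtain rfl : x₂ = b := hs
  exact ⟨hadj, ⟨hadj, ha.symm, h₂⟩, ⟨hb.symm, hadj.symm, h₃.symm⟩⟩

/-! ### Neighbour lists as one full turn around a node -/

theorem exists_firstDart (hT : G.IsOrderlySpanningTree T) (v : V) :
    ∃ d, G.firstDart T v = some d ∧ d.fst = v ∧ (v ≠ T.root → d.snd = T.parent v) := by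
  by_cases hv : v = T.root
  · have h : ∃ d : G.graph.Dart, d.fst = v ∧ G.leftFace d = G.externalFace := by
      subst hv
      exact hT.root_external
    refine ⟨G.rot h.choose, ?_, ?_, fun h => absurd hv h⟩
    · rw [firstDart, dif_neg (not_not.2 hv), dif_pos h]
    · rw [G.rot_fst]
      exact h.choose_spec.1
  · exact ⟨⟨(v, T.parent v), T.adj_parent v hv⟩, by rw [firstDart, dif_pos hv], rfl, fun _ => rfl⟩

theorem fst_iterate_rot (d : G.graph.Dart) (k : ℕ) : (G.rot^[k] d).fst = d.fst := by
  induction k with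
  | zero => rfl
  | succ k ih => rw [Function.iterate_succ_apply', G.rot_fst, ih]

theorem setOf_fst_eq_image (d : G.graph.Dart) [Finite V] :
    {e : G.graph.Dart | e.fst = d.fst} =
      (fun k => G.rot^[k] d) '' Set.Iio (Function.minimalPeriod G.rot d) := by
  have : Finite G.graph.Dart := Finite.of_injective _ SimpleGraph.Dart.toProd_injective
  ext e
  constructor
  · intro he
    obtain ⟨k, hk⟩ := (G.rot_cyclic d e (Eq.symm he)).exists_nat_pow_eq
    refine ⟨k % Function.minimalPeriod G.rot d, Nat.mod_lt _ ?_, ?_⟩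
    · exact Function.minimalPeriod_pos_of_mem_periodicPts (G.rot.injective.mem_periodicPts d)
    · simp only [Function.iterate_mod_minimalPeriod_eq]
      rw [← hk, Equiv.Perm.iterate_eq_pow]
  · rintro ⟨k, -, rfl⟩
    exact fst_iterate_rot d k

/-- The darts at a node form one cycle of `rot`, so iterating as often as the degree lists each
neighbour exactly once. -/
theorem card_neighborSet_eq_minimalPeriod (d : G.graph.Dart) [Finite V] :
    Nat.card (G.graph.neighborSet d.fst) = Function.minimalPeriod G.rot d := by
  have h₁ : Set.ncard {e : G.graph.Dart | e.fst = d.fst} = Function.minimalPeriod G.rot d := by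
    rw [setOf_fst_eq_image, Function.iterate_injOn_Iio_minimalPeriod.ncard_image,
      ← Finset.coe_Iio, Set.ncard_coe_finset, Nat.card_Iio]
  rw [← h₁]
  refine Nat.card_congr ⟨fun w => ⟨⟨(d.fst, w.1), w.2⟩, rfl⟩,
    fun e => ⟨e.1.snd, ?_⟩, fun w => rfl, ?_⟩
  · obtain ⟨e, he⟩ := e
    have := e.adj
    rwa [show e.fst = d.fst from he] at this
  · rintro ⟨e, he⟩
    exact Subtype.ext (SimpleGraph.Dart.ext _ _ (Prod.ext (Eq.symm he) rfl))

theorem dart_list (d : G.graph.Dart) [Finite V] :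
    (List.iterate G.rot d (Nat.card (G.graph.neighborSet d.fst))).Nodup ∧
      ∀ e, e ∈ List.iterate G.rot d (Nat.card (G.graph.neighborSet d.fst)) ↔ e.fst = d.fst := by
  rw [card_neighborSet_eq_minimalPeriod, ← List.range_map_iterate]
  constructor
  · refine List.Nodup.map_on ?_ List.nodup_range
    intro x hx y hy h
    exact Function.iterate_injOn_Iio_minimalPeriod (List.mem_range.1 hx) (List.mem_range.1 hy) h
  · intro e
    have := Set.ext_iff.1 (setOf_fst_eq_image d) e
    simpa [eq_comm] using this.symm

theorem ccwNeighbors_nodup [Finite V] (hT : G.IsOrderlySpanningTree T) (v : V) :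
    (G.ccwNeighbors T v).Nodup := by
  obtain ⟨d, hd, rfl, -⟩ := exists_firstDart hT v
  simp only [ccwNeighbors, hd]
  refine List.Nodup.map_on ?_ (dart_list d).1
  rintro ⟨⟨a, b⟩, h⟩ hx ⟨⟨a', b'⟩, h'⟩ hy hxy
  obtain rfl : a = d.fst := ((dart_list d).2 _).1 hx
  obtain rfl : a' = _ := ((dart_list d).2 _).1 hy
  obtain rfl : b = b' := hxy
  rfl

theorem mem_ccwNeighbors [Finite V] (hT : G.IsOrderlySpanningTree T) (v w : V) :
    w ∈ G.ccwNeighbors T v ↔ G.graph.Adj v w := by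
  obtain ⟨d, hd, rfl, -⟩ := exists_firstDart hT v
  simp only [ccwNeighbors, hd, List.mem_map, (dart_list d).2]
  constructor
  · rintro ⟨e, he, rfl⟩
    rw [← he]
    exact e.adj
  · intro h
    exact ⟨⟨(d.fst, w), h⟩, rfl, rfl⟩

theorem _root_.List.iterate_consecutive {α : Type*} {f : α → α} {n : ℕ} {x a b : α}
    {l₁ l₂ : List α} (h : List.iterate f x n = l₁ ++ a :: b :: l₂) : b = f a := by
  induction n generalizing x l₁ with
  | zero => simp at h
  | succ n ih =>
    rw [List.iterate] at h
    cases l₁ with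
    | cons y l =>
      rw [List.cons_append, List.cons.injEq] at h
      exact ih h.2
    | nil =>
      rw [List.nil_append, List.cons.injEq] at h
      obtain ⟨rfl, h⟩ := h
      cases n with
      | zero => simp at h
      | succ n =>
        rw [List.iterate, List.cons.injEq] at h
        exact h.1.symm

theorem next_of_ccwNeighbors_eq [Finite V] (hT : G.IsOrderlySpanningTree T) {v a b : V}
    {l₁ l₂ : List V} (h : G.ccwNeighbors T v = l₁ ++ a :: b :: l₂) : G.Next v a b := by
  obtain ⟨d, hd, rfl, -⟩ := exists_firstDart hT v
  simp only [ccwNeighbors, hd] at h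
  obtain ⟨m₁, m, hm, -, h₁⟩ := List.map_eq_append_iff.1 h
  obtain ⟨e, m, rfl, rfl, h₂⟩ := List.map_eq_cons_iff.1 h₁
  obtain ⟨e', m, rfl, rfl, -⟩ := List.map_eq_cons_iff.1 h₂
  have he : e.fst = d.fst := ((dart_list d).2 e).1 (by rw [hm]; simp)
  rw [List.iterate_consecutive hm, ← he]
  exact next_rot e

/-- The neighbour before `b` in the list is the one that `b` follows. -/
theorem getLast?_of_next [Finite V] (hT : G.IsOrderlySpanningTree T) {v a b : V} {l₁ l₂ : List V}
    (hn : G.Next v a b) (h : G.ccwNeighbors T v = l₁ ++ b :: l₂) (hne : l₁ ≠ []) :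
    l₁.getLast? = some a := by
  obtain ⟨l, c, rfl⟩ := l₁.eq_nil_or_concat'.resolve_left hne
  have : G.Next v c b := next_of_ccwNeighbors_eq hT (l₁ := l) (l₂ := l₂) (by rw [h]; simp)
  rw [hn.left_unique this]
  simp

/-- A node of degree one would have a neighbour following itself, and the triangle there would
contain a loop. -/
theorem ccwNeighbors_eq_cons [Finite V] (hG : G.IsTriangulation) (hT : G.IsOrderlySpanningTree T)
    {v : V} (hv : v ≠ T.root) : ∃ w l, G.ccwNeighbors T v = T.parent v :: w :: l := by
  obtain ⟨d, hd, rfl, hd'⟩ := exists_firstDart hT v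
  have hp := hd' hv
  have hmp : Function.minimalPeriod G.rot d ≠ 1 := by
    intro h
    rw [Function.minimalPeriod_eq_one_iff_isFixedPt] at h
    have hn : G.Next d.fst d.snd d.snd := ⟨d.adj, d.adj, h⟩
    exact (hn.triangle hG).1.ne rfl
  have : Finite G.graph.Dart := Finite.of_injective _ SimpleGraph.Dart.toProd_injective
  have hpos : 0 < Function.minimalPeriod G.rot d :=
    Function.minimalPeriod_pos_of_mem_periodicPts (G.rot.injective.mem_periodicPts d)
  obtain ⟨m, hm⟩ : ∃ m, Function.minimalPeriod G.rot d = m + 2 :=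
    ⟨Function.minimalPeriod G.rot d - 2, by omega⟩
  refine ⟨(G.rot d).snd, (List.iterate G.rot (G.rot (G.rot d)) m).map (fun e => e.snd), ?_⟩
  simp only [ccwNeighbors, hd]
  rw [card_neighborSet_eq_minimalPeriod, hm, List.iterate, List.iterate, List.map_cons,
    List.map_cons, hp]

/-! ## The blocks of an orderly node -/

variable (G T) in
open scoped Classical in
/-- The unrelated neighbours of `v` that precede `v`, in counterclockwise order. -/
noncomputable def earlier (v : V) : List V :=
  (G.ccwNeighbors T v).filter fun w => decide (T.Unrelated v w ∧ G.index T w < G.index T v)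

variable (G T) in
open scoped Classical in
/-- The unrelated neighbours of `v` that follow `v`, in counterclockwise order. -/
noncomputable def later (v : V) : List V :=
  (G.ccwNeighbors T v).filter fun w => decide (T.Unrelated v w ∧ G.index T v < G.index T w)

theorem hasCcwChildren [Finite V] (hT : G.IsOrderlySpanningTree T) : G.HasCcwChildren T := by
  classical
  intro v
  refine ⟨(ccwNeighbors_nodup hT v).filter _, fun w => ?_⟩
  rw [ccwChildren, List.mem_filter, decide_eq_true_iff, mem_ccwNeighbors hT]
  refine and_iff_right_of_imp ?_
  rintro ⟨hw, rfl⟩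
  exact (T.adj_parent w hw).symm

theorem mem_ccwChildren [Finite V] (hT : G.IsOrderlySpanningTree T) {v w : V} :
    w ∈ G.ccwChildren T v ↔ T.IsChild w v := (hasCcwChildren hT v).2 w

theorem mem_earlier [Finite V] (hT : G.IsOrderlySpanningTree T) {v w : V} :
    w ∈ G.earlier T v ↔ G.graph.Adj v w ∧ T.Unrelated v w ∧ G.index T w < G.index T v := by
  classical
  rw [earlier, List.mem_filter, decide_eq_true_iff, mem_ccwNeighbors hT]

theorem mem_later [Finite V] (hT : G.IsOrderlySpanningTree T) {v w : V} :
    w ∈ G.later T v ↔ G.graph.Adj v w ∧ T.Unrelated v w ∧ G.index T v < G.index T w := by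
  classical
  rw [later, List.mem_filter, decide_eq_true_iff, mem_ccwNeighbors hT]

/-- The four kinds of neighbours exclude each other, so filtering the list by one kind returns that
block in its order. -/
theorem ccwNeighbors_eq_blocks [Finite V] (hT : G.IsOrderlySpanningTree T) (v : V) :
    ∃ B, (∀ w, w ∈ B ↔ T.IsChild v w) ∧
      G.ccwNeighbors T v = B ++ (G.earlier T v ++ (G.ccwChildren T v ++ G.later T v)) := by
  classical
  obtain ⟨B₁, B₂, B₃, B₄, h, h₁, h₂, h₃, h₄⟩ := hT.orderly v
  have hpu : ∀ w, T.IsChild v w → ¬ T.Unrelated v w := fun w hw hu => hu.2.2 hw.isAncestor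
  have hcu : ∀ w, T.IsChild w v → ¬ T.Unrelated v w := fun w hw hu => hu.2.1 hw.isAncestor
  have hpc : ∀ w, T.IsChild v w → ¬ T.IsChild w v := fun w hw hc =>
    hw.isAncestor.1 (hw.isAncestor.above.antisymm hc.isAncestor.above)
  refine ⟨B₁, h₁, ?_⟩
  have e₂ : G.earlier T v = B₂ := by
    rw [earlier, h]
    simp only [List.filter_append]
    rw [List.filter_eq_nil_iff.2, List.filter_eq_self.2, List.filter_eq_nil_iff.2,
      List.filter_eq_nil_iff.2]
    · simp
    · intro w hw
      have := (h₄ w).1 hw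
      simp only [decide_eq_true_iff]
      omega
    · intro w hw
      simp only [decide_eq_true_iff]
      exact fun hu => hcu w ((h₃ w).1 hw) hu.1
    · intro w hw
      simpa using ((h₂ w).1 hw).2
    · intro w hw
      simp only [decide_eq_true_iff]
      exact fun hu => hpu w ((h₁ w).1 hw) hu.1
  have e₃ : G.ccwChildren T v = B₃ := by
    rw [ccwChildren, h]
    simp only [List.filter_append]
    rw [List.filter_eq_nil_iff.2, List.filter_eq_nil_iff.2, List.filter_eq_self.2,
      List.filter_eq_nil_iff.2]
    · simp
    · intro w hw
      simp only [decide_eq_true_iff]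
      exact fun hc => hcu w hc ((h₄ w).1 hw).2.1
    · intro w hw
      simpa using (h₃ w).1 hw
    · intro w hw
      simp only [decide_eq_true_iff]
      exact fun hc => hcu w hc ((h₂ w).1 hw).2.1
    · intro w hw
      simp only [decide_eq_true_iff]
      exact hpc w ((h₁ w).1 hw)
  have e₄ : G.later T v = B₄ := by
    rw [later, h]
    simp only [List.filter_append]
    rw [List.filter_eq_nil_iff.2, List.filter_eq_nil_iff.2, List.filter_eq_nil_iff.2,
      List.filter_eq_self.2]
    · simp
    · intro w hw
      simpa using ((h₄ w).1 hw).2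
    · intro w hw
      simp only [decide_eq_true_iff]
      exact fun hu => hcu w ((h₃ w).1 hw) hu.1
    · intro w hw
      have := (h₂ w).1 hw
      simp only [decide_eq_true_iff]
      omega
    · intro w hw
      simp only [decide_eq_true_iff]
      exact fun hu => hpu w ((h₁ w).1 hw) hu.1
  rw [e₂, e₃, e₄, h]
  simp

/-- The blocks exhaust the neighbours, so no edge joins a node to an ancestor other than its parent.
Thus Step 3 only concerns unrelated nodes. -/
theorem adj_cases [Finite V] (hT : G.IsOrderlySpanningTree T) {v w : V} (h : G.graph.Adj v w) :
    T.IsChild v w ∨ T.IsChild w v ∨ T.Unrelated v w := by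
  obtain ⟨B, hB, hl⟩ := ccwNeighbors_eq_blocks hT v
  have hw := (mem_ccwNeighbors hT v w).2 h
  rw [hl, List.mem_append, List.mem_append, List.mem_append, hB, mem_earlier hT,
    mem_ccwChildren hT, mem_later hT] at hw
  tauto

theorem block_ne_nil {v : V} (hv : v ≠ T.root) {B : List V} (hB : ∀ w, w ∈ B ↔ T.IsChild v w) :
    B ≠ [] := List.ne_nil_of_mem ((hB (T.parent v)).2 ⟨hv, rfl⟩)

/-- The neighbours of `v` after the parent of `v`. -/
theorem ccwNeighbors_nonroot [Finite V] (hT : G.IsOrderlySpanningTree T) {v : V}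
    (hv : v ≠ T.root) : G.ccwNeighbors T v =
      [T.parent v] ++ (G.earlier T v ++ (G.ccwChildren T v ++ G.later T v)) := by
  obtain ⟨B, hB, hl⟩ := ccwNeighbors_eq_blocks hT v
  have hnd := ccwNeighbors_nodup hT v
  rw [hl] at hnd
  have hB' : B = [T.parent v] := by
    have h₁ := (List.nodup_append.1 hnd).1
    rw [← List.perm_singleton, List.perm_ext_iff_of_nodup h₁ (List.nodup_singleton _)]
    intro w
    rw [hB, List.mem_singleton]
    exact ⟨fun h => h.2.symm, fun h => ⟨hv, h.symm⟩⟩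
  rw [hl, hB']

/-- The first neighbour after the parent. -/
theorem exists_next_parent [Finite V] (hG : G.IsTriangulation) (hT : G.IsOrderlySpanningTree T)
    {v : V} (hv : v ≠ T.root) : ∃ w, G.Next (T.parent v) w v ∧
      (G.earlier T v ++ (G.ccwChildren T v ++ G.later T v)).head? = some w := by
  obtain ⟨w, l, h⟩ := ccwNeighbors_eq_cons hG hT hv
  have hn : G.Next v (T.parent v) w := next_of_ccwNeighbors_eq hT (l₁ := []) h
  refine ⟨w, (hn.triangle hG).2.1, ?_⟩
  rw [ccwNeighbors_nonroot hT hv, List.singleton_append, List.cons.injEq] at h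
  rw [h.2]
  rfl

/-- The list around the parent is read backwards from `v`, skipping empty blocks. The last
alternative is the wrap-around at the root, whose list may start with `v`; nothing is claimed about
`w` there. -/
theorem next_child_cases [Finite V] (hT : G.IsOrderlySpanningTree T)
    {v w : V} (hv : v ≠ T.root) (hn : G.Next (T.parent v) w v) :
    (∃ l₁ l₂, G.ccwChildren T (T.parent v) = l₁ ++ w :: v :: l₂) ∨
    (∃ l, G.ccwChildren T (T.parent v) = v :: l) ∧ (G.earlier T (T.parent v)).getLast? = some w ∨
    T.IsChild (T.parent v) w ∨ (T.parent v = T.root ∧ ∃ l, G.ccwChildren T T.root = v :: l) := by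
  obtain ⟨B, hB, hl⟩ := ccwNeighbors_eq_blocks hT (T.parent v)
  obtain ⟨c₁, c₂, hc⟩ := List.append_of_mem ((mem_ccwChildren hT).2 ⟨hv, rfl⟩ : v ∈ _)
  have hl' : G.ccwNeighbors T (T.parent v) = (B ++ G.earlier T (T.parent v) ++ c₁) ++
      v :: (c₂ ++ G.later T (T.parent v)) := by
    rw [hl, hc]
    simp
  by_cases hnil : B ++ G.earlier T (T.parent v) ++ c₁ = []
  · have hr : T.parent v = T.root := by
      by_contra hr
      exact block_ne_nil hr hB (List.append_eq_nil_iff.1 (List.append_eq_nil_iff.1 hnil).1).1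
    refine Or.inr (Or.inr (Or.inr ⟨hr, c₂, ?_⟩))
    rw [← hr, hc, (List.append_eq_nil_iff.1 hnil).2, List.nil_append]
  · have hlast := getLast?_of_next hT hn hl' hnil
    rw [List.getLast?_append, List.getLast?_append] at hlast
    rcases List.eq_nil_or_concat' c₁ with rfl | ⟨c, x, rfl⟩
    · rcases List.eq_nil_or_concat' (G.earlier T (T.parent v)) with he | ⟨c, x, he⟩
      · rw [he] at hlast
        have : w ∈ B := List.mem_of_getLast? (by simpa using hlast)
        exact Or.inr (Or.inr (Or.inl ((hB w).1 this)))
      · refine Or.inr (Or.inl ⟨⟨c₂, hc⟩, ?_⟩)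
        rw [he] at hlast ⊢
        simpa using hlast
    · left
      obtain rfl : x = w := by simpa using hlast
      exact ⟨c, c₂, by rw [hc]; simp⟩

/-- The first earlier neighbour is the previous sibling, or else the last earlier neighbour of the
parent. -/
theorem first_earlier [Finite V] (hG : G.IsTriangulation) (hT : G.IsOrderlySpanningTree T)
    {v w : V} {l : List V} (hv : v ≠ T.root) (h : G.earlier T v = w :: l) :
    (∃ l₁ l₂, G.ccwChildren T (T.parent v) = l₁ ++ w :: v :: l₂) ∨
    (∃ l, G.ccwChildren T (T.parent v) = v :: l) ∧
      (G.earlier T (T.parent v)).getLast? = some w := by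
  have hC := hasCcwChildren hT
  obtain ⟨w', hn, hw'⟩ := exists_next_parent hG hT hv
  rw [h, List.cons_append, List.head?_cons, Option.some.injEq] at hw'
  subst hw'
  have hw := (mem_earlier hT).1 (by rw [h]; simp : w ∈ G.earlier T v)
  rcases next_child_cases hT hv hn with h' | h' | h' | ⟨hr, l', h'⟩
  · exact Or.inl h'
  · exact Or.inr h'
  · exact absurd (h'.isAncestor.above.trans (above_parent v)) (unrelated_iff.1 hw.2.1).2
  · have := index_le_of_lt_first_child hC h' hw.2.2
    have := index_injective hC (this.antisymm (index_le_of_above hC (root_above w)))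
    exact absurd this hw.2.1.ne_root_right

/-- A node without earlier neighbours is the root or is not the last node. -/
theorem exists_index_lt_of_earlier_eq_nil [Finite V] (hG : G.IsTriangulation)
    (hT : G.IsOrderlySpanningTree T) {v : V} (hv : v ≠ T.root) (h : G.earlier T v = []) :
    ∃ w, G.index T v < G.index T w := by
  obtain ⟨w, -, hw⟩ := exists_next_parent hG hT hv
  rw [h, List.nil_append] at hw
  have hm := List.mem_of_head? hw
  rw [List.mem_append, mem_ccwChildren hT, mem_later hT] at hm
  rcases hm with hm | hm
  · exact ⟨w, index_lt_of_isAncestor (hasCcwChildren hT) hm.isAncestor⟩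
  · exact ⟨w, hm.2.2⟩

/-- Consecutive earlier neighbours: the second one is the last child of the first one, or else
the first one is a leaf and the second one is its last earlier neighbour. -/
theorem consecutive_earlier [Finite V] (hG : G.IsTriangulation) (hT : G.IsOrderlySpanningTree T)
    {v a b : V} {l₁ l₂ : List V} (h : G.earlier T v = l₁ ++ a :: b :: l₂) :
    (∃ l, G.ccwChildren T a = l ++ [b]) ∨
    (G.ccwChildren T a = [] ∧ (G.earlier T a).getLast? = some b) := by
  obtain ⟨B, -, hl⟩ := ccwNeighbors_eq_blocks hT v
  have ha := (mem_earlier hT).1 (by rw [h]; simp : a ∈ G.earlier T v)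
  have hb := (mem_earlier hT).1 (by rw [h]; simp : b ∈ G.earlier T v)
  have hn : G.Next v a b := next_of_ccwNeighbors_eq hT (l₁ := B ++ l₁)
    (l₂ := l₂ ++ (G.ccwChildren T v ++ G.later T v)) (by rw [hl, h]; simp)
  obtain ⟨-, hna, hnb⟩ := hn.triangle hG
  have har := ha.2.1.ne_root_right
  have hbr := hb.2.1.ne_root_right
  have hva : v ∈ G.later T a := (mem_later hT).2 ⟨ha.1.symm, ha.2.1.symm, ha.2.2⟩
  have hvb : v ∈ G.later T b := (mem_later hT).2 ⟨hb.1.symm, hb.2.1.symm, hb.2.2⟩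
  -- Around `b`, the node `a` directly follows `v`, and `v` lies in the final block; so `a` cannot
  -- lie in the blocks of earlier neighbours or children of `b`.
  have key : ∀ m ∈ G.earlier T b ++ G.ccwChildren T b, m = a → False := by
    rintro m hm rfl
    obtain ⟨m₁, m₂, hm⟩ := List.append_of_mem hm
    have hbl : G.ccwNeighbors T b = ([T.parent b] ++ m₁) ++ m :: (m₂ ++ G.later T b) := by
      rw [ccwNeighbors_nonroot hT hbr, ← List.append_assoc (G.earlier T b), hm]
      simp
    have hlast := List.mem_of_getLast? (getLast?_of_next hT hnb hbl (by simp))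
    have hnd := ccwNeighbors_nodup hT b
    rw [ccwNeighbors_nonroot hT hbr, ← List.append_assoc (G.earlier T b), hm,
      ← List.append_assoc] at hnd
    exact (List.nodup_append.1 hnd).2.2 v (by simp at hlast ⊢; tauto) v hvb rfl
  -- Around `a`, the node `b` directly precedes `v`. Reading back from `v`, the options that `b` is
  -- a later neighbour or the parent of `a` are excluded by `key`.
  obtain ⟨e₁, e₂, he⟩ := List.append_of_mem hva
  have hal : G.ccwNeighbors T a =
      ([T.parent a] ++ (G.earlier T a ++ (G.ccwChildren T a ++ e₁))) ++ v :: e₂ := by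
    rw [ccwNeighbors_nonroot hT har, he]
    simp
  have hlast := getLast?_of_next hT hna hal (by simp)
  rcases List.eq_nil_or_concat' e₁ with rfl | ⟨c, x, rfl⟩
  · rcases List.eq_nil_or_concat' (G.ccwChildren T a) with hc | ⟨c, x, hc⟩
    · rcases List.eq_nil_or_concat' (G.earlier T a) with hd | ⟨c, x, hd⟩
      · rw [hc, hd] at hlast
        obtain rfl : T.parent a = b := by simpa using hlast
        exact (key a (List.mem_append_right _ ((mem_ccwChildren hT).2 ⟨har, rfl⟩)) rfl).elim
      · right
        refine ⟨hc, ?_⟩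
        rw [hc, hd] at hlast
        simp only [← List.append_assoc, List.append_nil, List.getLast?_append,
          List.getLast?_singleton, Option.some_or, Option.some.injEq] at hlast
        rw [hd, hlast, List.getLast?_append, List.getLast?_singleton, Option.some_or]
    · left
      rw [hc] at hlast
      simp only [← List.append_assoc, List.append_nil, List.getLast?_append,
        List.getLast?_singleton, Option.some_or, Option.some.injEq] at hlast
      exact ⟨c, by rw [hc, hlast]⟩
  · simp only [← List.append_assoc, List.getLast?_append, List.getLast?_singleton,
      Option.some_or, Option.some.injEq] at hlast
    subst hlast
    have hxa := (mem_later hT).1 (by rw [he]; simp : x ∈ G.later T a)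
    exact (key a (List.mem_append_left _
      ((mem_earlier hT).2 ⟨hxa.1.symm, hxa.2.1.symm, hxa.2.2⟩)) rfl).elim

end PlaneGraph

/-! ## Levels: an upper bound for the bottom sides -/

/-- Points can be placed on a line one after the other, each of them either directly to the left of
a given earlier point or to the right of all earlier points. -/
theorem exists_rank {V : Type*} [Finite V] (idx : V → ℕ) (hidx : Function.Injective idx)
    (t : V → Option V) (ht : ∀ v w, t v = some w → idx w < idx v) :
    ∃ r : V → ℚ, ∀ v, (∀ w, t v = some w → r v < r w) ∧
      ∀ y, idx y < idx v → (∀ w, t v = some w → r y < r w) → r y < r v := by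
  classical
  have := Fintype.ofFinite V
  suffices h : ∀ i, ∃ r : V → ℚ, ∀ v, idx v < i → (∀ w, t v = some w → r v < r w) ∧
      ∀ y, idx y < idx v → (∀ w, t v = some w → r y < r w) → r y < r v by
    obtain ⟨b, hb⟩ := (Set.finite_range idx).bddAbove
    obtain ⟨r, hr⟩ := h (b + 1)
    exact ⟨r, fun v => hr v (Nat.lt_succ_of_le (hb ⟨v, rfl⟩))⟩
  intro i
  induction i with
  | zero => exact ⟨fun _ => 0, fun v hv => absurd hv (Nat.not_lt_zero _)⟩
  | succ i ih =>
    obtain ⟨r, hr⟩ := ih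
    by_cases hv : ∃ v, idx v = i
    · obtain ⟨v, rfl⟩ := hv
      -- The new point goes between its target and all earlier points left of the target, by density
      -- of ℚ. Without a target the upper set is empty and the lower set contains all earlier
      -- points.
      obtain ⟨m, hlo, hhi⟩ := Order.exists_between_finsets
        ((Finset.univ.filter fun y => idx y < idx v ∧ ∀ w, t v = some w → r y < r w).image r)
        ((Finset.univ.filter fun w => t v = some w).image r) (by
          intro x hx y hy
          simp only [Finset.mem_image, Finset.mem_filter, Finset.mem_univ, true_and] at hx hy
          obtain ⟨x, hx, rfl⟩ := hx
          obtain ⟨y, hy, rfl⟩ := hy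
          exact hx.2 y hy)
      have hup : ∀ y, idx y < idx v → Function.update r v m y = r y := fun y hy =>
        Function.update_of_ne (by rintro rfl; exact lt_irrefl _ hy) _ _
      refine ⟨Function.update r v m, fun u hu => ?_⟩
      by_cases huv : u = v
      · subst huv
        rw [Function.update_self]
        constructor
        · intro w hw
          rw [hup w (ht u w hw)]
          exact hhi _ (Finset.mem_image_of_mem _ (by simpa using hw))
        · intro y hy h
          rw [hup y hy] at h ⊢
          refine hlo _ (Finset.mem_image_of_mem _ ?_)
          simp only [Finset.mem_filter, Finset.mem_univ, true_and]
          refine ⟨hy, fun w hw => ?_⟩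
          have := h w hw
          rwa [hup w (ht u w hw)] at this
      · have hlt : idx u < idx v :=
          lt_of_le_of_ne (Nat.lt_succ_iff.1 hu) fun h => huv (hidx h)
        rw [hup u hlt]
        constructor
        · intro w hw
          rw [hup w ((ht u w hw).trans hlt)]
          exact (hr u hlt).1 w hw
        · intro y hy h
          rw [hup y (hy.trans hlt)] at h ⊢
          refine (hr u hlt).2 y hy fun w hw => ?_
          have := h w hw
          rwa [hup w ((ht u w hw).trans hlt)] at this
    · refine ⟨r, fun v hv' => hr v (lt_of_le_of_ne (Nat.lt_succ_iff.1 hv') fun h => hv ⟨v, h⟩)⟩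

namespace PlaneGraph

open RootedSpanningTree

variable {V : Type*} {G : PlaneGraph V} {T : RootedSpanningTree G.graph}

/-- A rank function that places each node directly before its last earlier neighbour. -/
def IsRank (G : PlaneGraph V) (T : RootedSpanningTree G.graph) (r : V → ℚ) : Prop :=
  ∀ v, (∀ w, (G.earlier T v).getLast? = some w → r v < r w) ∧
    ∀ y, G.index T y < G.index T v →
      (∀ w, (G.earlier T v).getLast? = some w → r y < r w) → r y < r v

theorem index_lt_of_getLast?_earlier [Finite V] (hT : G.IsOrderlySpanningTree T) {v w : V}
    (h : (G.earlier T v).getLast? = some w) : G.index T w < G.index T v :=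
  ((mem_earlier hT).1 (List.mem_of_getLast? h)).2.2

theorem exists_isRank [Finite V] (hT : G.IsOrderlySpanningTree T) : ∃ r, G.IsRank T r :=
  exists_rank (G.index T) (index_injective (hasCcwChildren hT)) _
    fun _ _ h => index_lt_of_getLast?_earlier hT h

theorem not_above_of_ccwChildren_eq_nil [Finite V] (hT : G.IsOrderlySpanningTree T) {a x : V}
    (h : G.ccwChildren T a = []) (hne : x ≠ a) : ¬ T.Above a x := by
  intro hax
  obtain ⟨c, hc, -⟩ := hax.exists_child hne
  have := (mem_ccwChildren hT).2 hc
  rw [h] at this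
  simp at this

/-- The three claims need each other at smaller indices, hence the strong induction. For fixed `v`
the claims on earlier neighbours are carried along their list: `first_earlier` starts it and
`consecutive_earlier` continues it. The parent then lies left of the last earlier neighbour, and `v`
is placed directly before that one, so the parent lies left of `v`. -/
theorem IsRank.aux [Finite V] (hG : G.IsTriangulation) (hT : G.IsOrderlySpanningTree T)
    {r : V → ℚ} (hr : G.IsRank T r) (v : V) (hv : v ≠ T.root) :
    r (T.parent v) < r v ∧ ∀ w ∈ G.earlier T v, r (T.parent v) < r w ∧
      ∀ x, G.index T w < G.index T x → G.index T x < G.index T v → ¬ T.Above w x → r x < r w := by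
  have hC := hasCcwChildren hT
  induction hn : G.index T v using Nat.strong_induction_on generalizing v with
  | _ n ih =>
  subst hn
  have hp := index_parent_lt hC hv
  have key : ∀ l₁ w l₂, G.earlier T v = l₁ ++ w :: l₂ → r (T.parent v) < r w ∧
      ∀ x, G.index T w < G.index T x → G.index T x < G.index T v → ¬ T.Above w x → r x < r w := by
    intro l₁
    induction l₁ using List.reverseRecOn with
    | nil =>
      intro w l₂ h
      have hw := (mem_earlier hT).1 (by rw [h]; simp : w ∈ G.earlier T v)
      rcases first_earlier hG hT hv h with ⟨m₁, m₂, hm⟩ | ⟨⟨m, hm⟩, hl⟩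
      · have hwp : T.IsChild w (T.parent v) := (mem_ccwChildren hT).1 (by rw [hm]; simp)
        refine ⟨?_, fun x h₁ h₂ h₃ =>
          absurd (above_of_index_between_siblings hC hm h₁.le h₂) h₃⟩
        have := (ih _ hw.2.2 w hwp.1 rfl).1
        rwa [hwp.2] at this
      · have hpw := (hr (T.parent v)).1 w hl
        have hwm := List.mem_of_getLast? hl
        have hpr := ((mem_earlier hT).1 hwm).2.1.ne_root_left
        refine ⟨hpw, fun x h₁ h₂ h₃ => ?_⟩
        rcases (index_le_of_lt_first_child hC hm h₂).lt_or_eq with h₄ | h₄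
        · exact ((ih _ hp _ hpr rfl).2 w hwm).2 x h₁ h₄ h₃
        · rwa [index_injective hC h₄]
    | append_singleton l a ihl =>
      intro w l₂ h
      rw [List.append_assoc, List.singleton_append] at h
      have ha := (mem_earlier hT).1 (by rw [h]; simp : a ∈ G.earlier T v)
      have hw := (mem_earlier hT).1 (by rw [h]; simp : w ∈ G.earlier T v)
      obtain ⟨h₁, h₂⟩ := ihl a _ h
      rcases consecutive_earlier hG hT h with ⟨m, hm⟩ | ⟨hm, hl⟩
      · have hwa : T.IsChild w a := (mem_ccwChildren hT).1 (by rw [hm]; simp)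
        have haw := (ih _ hw.2.2 w hwa.1 rfl).1
        rw [hwa.2] at haw
        refine ⟨h₁.trans haw, fun x h₃ h₄ h₅ => (h₂ x ?_ h₄ ?_).trans haw⟩
        · exact (index_lt_of_isAncestor hC hwa.isAncestor).trans h₃
        · exact fun h₆ => h₅ (above_last_child hC hm h₆ h₃)
      · have haw := (hr a).1 w hl
        refine ⟨h₁.trans haw, fun x h₃ h₄ h₅ => ?_⟩
        rcases lt_trichotomy (G.index T x) (G.index T a) with h₆ | h₆ | h₆
        · exact ((ih _ ha.2.2 a ha.2.1.ne_root_right rfl).2 w (List.mem_of_getLast? hl)).2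
            x h₃ h₆ h₅
        · rwa [index_injective hC h₆]
        · refine (h₂ x h₆ h₄ (not_above_of_ccwChildren_eq_nil hT hm ?_)).trans haw
          rintro rfl
          exact lt_irrefl _ h₆
  have key' : ∀ w ∈ G.earlier T v, r (T.parent v) < r w ∧
      ∀ x, G.index T w < G.index T x → G.index T x < G.index T v → ¬ T.Above w x → r x < r w := by
    intro w hw
    obtain ⟨l₁, l₂, h⟩ := List.append_of_mem hw
    exact key l₁ w l₂ h
  exact ⟨(hr v).2 _ hp fun w hw => (key' w (List.mem_of_getLast? hw)).1, key'⟩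

theorem IsRank.parent_lt [Finite V] (hG : G.IsTriangulation) (hT : G.IsOrderlySpanningTree T)
    {r : V → ℚ} (hr : G.IsRank T r) {v : V} (hv : v ≠ T.root) : r (T.parent v) < r v :=
  (hr.aux hG hT v hv).1

/-- Each step along the list goes to a child or to the last earlier neighbour of the current node,
and both moves increase the rank. -/
theorem IsRank.le_of_getLast? [Finite V] (hG : G.IsTriangulation)
    (hT : G.IsOrderlySpanningTree T) {r : V → ℚ} (hr : G.IsRank T r) {v w z : V}
    (hw : w ∈ G.earlier T v) (hz : (G.earlier T v).getLast? = some z) : r w ≤ r z := by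
  obtain ⟨l₁, l₂, h⟩ := List.append_of_mem hw
  clear hw
  induction l₂ generalizing l₁ w with
  | nil =>
    rw [h, List.getLast?_append, List.getLast?_singleton, Option.some_or,
      Option.some.injEq] at hz
    rw [hz]
  | cons b l ih =>
    refine le_trans (le_of_lt ?_) (ih (l₁ ++ [w]) (w := b) (by rw [h]; simp))
    rcases consecutive_earlier hG hT h with ⟨m, hm⟩ | ⟨-, hl⟩
    · have hb : T.IsChild b w := (mem_ccwChildren hT).1 (by rw [hm]; simp)
      have := hr.parent_lt hG hT hb.1
      rwa [hb.2] at this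
    · exact (hr w).1 b hl

theorem IsRank.lt_of_lt_earlier [Finite V] (hG : G.IsTriangulation)
    (hT : G.IsOrderlySpanningTree T) {r : V → ℚ} (hr : G.IsRank T r) {v w y : V}
    (hw : w ∈ G.earlier T v) (hy : G.index T y < G.index T v) (h : r y < r w) : r y < r v :=
  (hr v).2 y hy fun _ hz => h.trans_le (hr.le_of_getLast? hG hT hw hz)

/-- Some node without earlier neighbours is at least as far to the right as `v`. -/
theorem IsRank.exists_earlier_eq_nil [Finite V] (hT : G.IsOrderlySpanningTree T) {r : V → ℚ}
    (hr : G.IsRank T r) (v : V) (hv : v ≠ T.root) :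
    ∃ s, s ≠ T.root ∧ G.earlier T s = [] ∧ r v ≤ r s := by
  induction hn : G.index T v using Nat.strong_induction_on generalizing v with
  | _ n ih =>
  subst hn
  rcases List.eq_nil_or_concat' (G.earlier T v) with h | ⟨l, w, h⟩
  · exact ⟨v, hv, h, le_rfl⟩
  · have hl : (G.earlier T v).getLast? = some w := by rw [h]; simp
    have hw := (mem_earlier hT).1 (List.mem_of_getLast? hl)
    obtain ⟨s, hs, hs', hws⟩ := ih _ hw.2.2 w hw.2.1.ne_root_right rfl
    exact ⟨s, hs, hs', ((hr v).1 w hl).le.trans hws⟩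

/-- Levels that increase strictly wherever a bottom side has to be lower than another one. -/
structure IsLevel (G : PlaneGraph V) (T : RootedSpanningTree G.graph) (L : V → ℤ) : Prop where
  one_le : ∀ v, 1 ≤ L v
  le_card : ∀ v, L v ≤ (Nat.card V : ℤ) - 1
  parent_lt : ∀ v, v ≠ T.root → L (T.parent v) < L v
  parent_lt_of_adj : ∀ u w, G.graph.Adj u w → T.Unrelated u w → L (T.parent u) < L w
  lt_of_between : ∀ u w x, G.graph.Adj u w → T.Unrelated u w → T.Unrelated u x →
    T.Unrelated x w → G.index T u < G.index T x → G.index T x < G.index T w →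
    L x < L u ∧ L x < L w

/-- The level counts the nodes of smaller rank, except the last node `e` of the preorder. Omitting
`e` keeps an inequality strict unless `e` is its smaller side, and that side always precedes some
node. -/
theorem exists_isLevel [Finite V] (hG : G.IsTriangulation) (hT : G.IsOrderlySpanningTree T) :
    ∃ L, G.IsLevel T L := by
  classical
  have := Fintype.ofFinite V
  have hC := hasCcwChildren hT
  obtain ⟨r, hr⟩ := exists_isRank hT
  have hcard : Nat.card V = Fintype.card V := Nat.card_eq_fintype_card
  have h3 := hG.three_le_card
  have : Nontrivial V := Fintype.one_lt_card_iff_nontrivial.1 (by omega)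
  obtain ⟨e, he⟩ := Finite.exists_max (G.index T)
  have her : e ≠ T.root := by
    rintro rfl
    obtain ⟨v, hv⟩ := exists_ne T.root
    have := index_lt_of_isAncestor hC (a := T.root) (x := v) ⟨hv.symm, root_above v⟩
    have := he v
    omega
  -- Not counting `e` saves nothing in the level of `e` itself. There the node `s`, ranked at least
  -- as high, is the second one that is not counted.
  obtain ⟨s, hs, hs', hes⟩ := hr.exists_earlier_eq_nil hT e her
  have hse : s ≠ e := by
    rintro rfl
    obtain ⟨w, hw⟩ := exists_index_lt_of_earlier_eq_nil hG hT hs hs'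
    have := he w
    omega
  have hne : ∀ x y, G.index T x < G.index T y → x ≠ e := by
    rintro x y h rfl
    have := he y
    omega
  set F : V → Finset V := fun x => Finset.univ.filter fun z => z ≠ e ∧ r z < r x with hF
  have hlt : ∀ x y, x ≠ e → r x < r y → ((F x).card : ℤ) + 1 < (F y).card + 1 := by
    intro x y hx hxy
    have : F x ⊂ F y := by
      rw [Finset.ssubset_iff_of_subset]
      · exact ⟨x, by simp [hF, hx, hxy], by simp [hF]⟩
      · intro z hz
        simp only [hF, Finset.mem_filter, Finset.mem_univ, true_and] at hz ⊢
        exact ⟨hz.1, hz.2.trans hxy⟩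
    have := Finset.card_lt_card this
    omega
  have hadj : ∀ u w, G.graph.Adj u w → T.Unrelated u w → G.index T u < G.index T w →
      u ∈ G.earlier T w := fun u w h₁ h₂ h₃ => (mem_earlier hT).2 ⟨h₁.symm, h₂.symm, h₃⟩
  refine ⟨fun x => (F x).card + 1, ?_, ?_, ?_, ?_, ?_⟩
  · intro v
    simp
  · intro v
    obtain ⟨x, hx, hxF⟩ : ∃ x, x ≠ e ∧ x ∉ F v := by
      by_cases hv : v = e
      · subst hv
        exact ⟨s, hse, by simp [hF, hse, hes]⟩
      · exact ⟨v, hv, by simp [hF]⟩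
    have hsub : F v ⊆ Finset.univ \ {x, e} := by
      intro z hz
      simp only [Finset.mem_sdiff, Finset.mem_univ, Finset.mem_insert, Finset.mem_singleton,
        true_and, not_or]
      exact ⟨by rintro rfl; exact hxF hz, (Finset.mem_filter.1 hz).2.1⟩
    have h₁ := Finset.card_le_card hsub
    rw [Finset.card_sdiff_of_subset (Finset.subset_univ _), Finset.card_pair hx,
      Finset.card_univ] at h₁
    rw [hcard]
    omega
  · intro v hv
    exact hlt _ _ (hne _ _ (index_parent_lt hC hv)) (hr.parent_lt hG hT hv)
  · intro u w h₁ h₂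
    refine hlt _ _ (hne _ _ (index_parent_lt hC h₂.ne_root_left)) ?_
    rcases lt_trichotomy (G.index T u) (G.index T w) with h | h | h
    · have hu := hadj u w h₁ h₂ h
      exact hr.lt_of_lt_earlier hG hT hu ((index_parent_lt hC h₂.ne_root_left).trans h)
        (hr.parent_lt hG hT h₂.ne_root_left)
    · exact absurd (index_injective hC h) h₂.1
    · exact ((hr.aux hG hT u h₂.ne_root_left).2 w (hadj w u h₁.symm h₂.symm h)).1
  · intro u w x h₁ h₂ h₃ h₄ h₅ h₆
    have hu := hadj u w h₁ h₂ (h₅.trans h₆)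
    have hx : r x < r u := ((hr.aux hG hT w h₂.ne_root_right).2 u hu).2 x h₅ h₆
      (unrelated_iff.1 h₃).1
    exact ⟨hlt _ _ (hne _ _ h₆) hx, hlt _ _ (hne _ _ h₆) (hr.lt_of_lt_earlier hG hT hu h₆ hx)⟩

end PlaneGraph

/-! ## Leaves and first children -/

namespace PlaneGraph

open RootedSpanningTree

variable {V : Type*} {G : PlaneGraph V} {T : RootedSpanningTree G.graph}

/-- `v` is a child, but not the first child of its parent. -/
def IsLaterChild (G : PlaneGraph V) (T : RootedSpanningTree G.graph) (v : V) : Prop :=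
  v ≠ T.root ∧ (G.ccwChildren T (T.parent v)).head? ≠ some v

/-- Sending a first child to its parent is a bijection onto the nodes that are not leaves; every
remaining node other than the root is a later child. -/
theorem numLeaves_eq [Finite V] (hC : G.HasCcwChildren T) :
    T.numLeaves = {v | G.IsLaterChild T v}.ncard + 1 := by
  have h₁ : T.parent '' {v | v ≠ T.root ∧ (G.ccwChildren T (T.parent v)).head? = some v} =
      {v | ∀ w, ¬ T.IsChild w v}ᶜ := by
    ext a
    simp only [Set.mem_image, Set.mem_ofPred_eq, Set.mem_compl_iff, not_forall, not_not]
    constructor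
    · rintro ⟨v, hv, rfl⟩
      exact ⟨v, hv.1, rfl⟩
    · rintro ⟨w, hw⟩
      have hm := ((hC a).2 w).2 hw
      obtain ⟨v, l, hl⟩ := List.exists_cons_of_ne_nil (List.ne_nil_of_mem hm)
      have hv : T.IsChild v a := ((hC a).2 v).1 (by rw [hl]; simp)
      exact ⟨v, ⟨hv.1, by rw [hv.2, hl]; rfl⟩, hv.2⟩
  have h₂ : Set.InjOn T.parent
      {v | v ≠ T.root ∧ (G.ccwChildren T (T.parent v)).head? = some v} := by
    intro v hv w hw h
    have h₁ := hv.2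
    rw [h, hw.2, Option.some.injEq] at h₁
    exact h₁.symm
  have h₃ := h₂.ncard_image
  rw [h₁] at h₃
  have h₄ := Set.ncard_add_ncard_compl {v : V | ∀ w, ¬ T.IsChild w v}
  have h₅ := Set.ncard_add_ncard_compl {v | G.IsLaterChild T v}
  have h₆ : {v | G.IsLaterChild T v}ᶜ = insert T.root
      {v | v ≠ T.root ∧ (G.ccwChildren T (T.parent v)).head? = some v} := by
    ext v
    simp only [IsLaterChild, Set.mem_compl_iff, Set.mem_ofPred_eq, Set.mem_insert_iff]
    tauto
  rw [h₆, Set.ncard_insert_of_notMem (by simp)] at h₅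
  rw [numLeaves]
  change Nat.card {v : V | ∀ w, ¬ T.IsChild w v} = _
  rw [Nat.card_coe_set_eq]
  omega

/-! ## Intermediate drawings -/

/-- The properties of the drawing of the first `i` nodes that all steps preserve. -/
structure IsGood (G : PlaneGraph V) (T : RootedSpanningTree G.graph) (L : V → ℤ) (i : ℕ)
    (D : DrawState V) : Prop where
  mem_drawn : ∀ v, v ∈ D.drawn ↔ G.index T v < i
  width : ∀ v ∈ D.drawn, D.left v + 1 ≤ D.right v
  nested : ∀ a, ∀ v ∈ D.drawn, T.IsAncestor a v → D.left a ≤ D.left v ∧ D.right v ≤ D.right a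
  apart : ∀ u, ∀ v ∈ D.drawn, T.Unrelated u v → G.index T u < G.index T v → D.right u ≤ D.left v
  height : ∀ v ∈ D.drawn, G.topSide T D v + 1 ≤ D.bottom v
  level : ∀ v ∈ D.drawn, D.bottom v ≤ L v
  left_root : T.root ∈ D.drawn → D.left T.root = 0
  right_root : T.root ∈ D.drawn →
    D.right T.root = ({v | G.IsLaterChild T v ∧ G.index T v < i}.ncard : ℤ) + 1

theorem topSide_root (D : DrawState V) : G.topSide T D T.root = 0 := if_pos rfl

theorem topSide_of_ne {v : V} (hv : v ≠ T.root) (D : DrawState V) :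
    G.topSide T D v = D.bottom (T.parent v) := if_neg hv

theorem isGood_emptyState {L : V → ℤ} : G.IsGood T L 0 emptyState where
  mem_drawn v := by simp [emptyState]
  width v hv := by simp [emptyState] at hv
  nested a v hv := by simp [emptyState] at hv
  apart a v hv := by simp [emptyState] at hv
  height v hv := by simp [emptyState] at hv
  level v hv := by simp [emptyState] at hv
  left_root hv := by simp [emptyState] at hv
  right_root hv := by simp [emptyState] at hv

variable {D : DrawState V}

/-- This replaces the condition on the whole path from `u` by a recursion along parent pointers. -/
theorem movesWith_parent_iff {u v : V} (hv : v ≠ T.root) (hvu : v ≠ u) :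
    G.MovesWith T D u v ↔ G.MovesWith T D u (T.parent v) ∧
      D.bottom v = D.bottom (T.parent v) + 1 := by
  constructor
  · rintro (h | ⟨h₁, h₂⟩)
    · exact absurd h hvu
    · have h₃ := h₂ v (Or.inl rfl) h₁
      rw [topSide_of_ne hv] at h₃
      refine ⟨?_, h₃⟩
      by_cases hp : T.parent v = u
      · exact Or.inl hp
      · refine Or.inr ⟨⟨Ne.symm hp, (isAncestor_iff_parent.1 h₁).2⟩, fun z hz => h₂ z (Or.inr ?_)⟩
        rcases hz with rfl | hz
        · exact isAncestor_parent hv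
        · exact isAncestor_iff_parent.2 ⟨hv, hz.above⟩
  · rintro ⟨h₁, h₂⟩
    have hup : T.Above u (T.parent v) := by
      rcases h₁ with h | h
      · rw [h]; exact Above.refl _ _
      · exact h.1.above
    refine Or.inr ⟨isAncestor_iff_parent.2 ⟨hv, hup⟩, ?_⟩
    rintro z (rfl | hz) huz
    · rwa [topSide_of_ne hv]
    · have hz' := (isAncestor_iff_parent.1 hz).2
      rcases h₁ with h | h
      · rw [h] at hz'
        exact absurd (huz.above.antisymm hz') huz.1
      · by_cases hzp : z = T.parent v
        · exact h.2 z (Or.inl hzp) huz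
        · exact h.2 z (Or.inr ⟨hzp, hz'⟩) huz

theorem bottom_lengthen_le (D : DrawState V) (v : V) :
    D.bottom v ≤ (G.lengthen T D).bottom v ∧ (G.lengthen T D).bottom v ≤ D.bottom v + 1 := by
  simp only [lengthen]
  split_ifs <;> omega

/-- Of two nodes that fail to see each other, the one ending higher is too short, so an unsettled
drawing always changes. -/
theorem exists_isTooShort (h : ¬ G.IsSettled T D) : ∃ u ∈ D.drawn, G.IsTooShort T D u := by
  simp only [IsSettled, not_forall] at h
  obtain ⟨u, w, hm, hv⟩ := h
  rcases le_total (D.bottom u) (D.bottom w) with hle | hle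
  · exact ⟨u, hm.1, w, hm, hv, hle⟩
  · exact ⟨w, hm.2.1, u, ⟨hm.2.1, hm.1, hm.2.2.1.symm, hm.2.2.2.2, hm.2.2.2.1⟩,
      fun h => hv h.symm, hle⟩

/-! ### Visibility in an intermediate drawing -/

namespace IsGood

variable [Finite V] {L : V → ℤ} {i : ℕ}

theorem parent_mem (hC : G.HasCcwChildren T) (hD : G.IsGood T L i D) {v : V} (hv : v ∈ D.drawn) :
    T.parent v ∈ D.drawn := by
  rw [hD.mem_drawn] at hv ⊢
  exact (index_le_of_above hC (above_parent v)).trans_lt hv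

theorem bottom_le_of_above (hC : G.HasCcwChildren T) (hD : G.IsGood T L i D) {a v : V}
    (hv : v ∈ D.drawn) (h : T.Above a v) : D.bottom a ≤ D.bottom v := by
  obtain ⟨k, hk⟩ := h
  induction k generalizing v with
  | zero => rw [← hk]; rfl
  | succ k ih =>
    rw [Function.iterate_succ_apply] at hk
    have h₁ := ih (hD.parent_mem hC hv) hk
    by_cases hr : v = T.root
    · rwa [hr, T.parent_root, ← hr] at h₁
    · have h₂ := hD.height v hv
      rw [topSide_of_ne hr] at h₂
      omega

theorem bottom_le_topSide (hC : G.HasCcwChildren T) (hD : G.IsGood T L i D) {a v : V}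
    (hv : v ∈ D.drawn) (h : T.IsAncestor a v) : D.bottom a ≤ G.topSide T D v := by
  rw [topSide_of_ne h.ne_root]
  exact hD.bottom_le_of_above hC (hD.parent_mem hC hv) (isAncestor_iff_parent.1 h).2

/-- Two unrelated rectangles see each other along the unit row below `m` if both of them reach
across this row and everything between them ends above it. -/
theorem seesRight (hC : G.HasCcwChildren T) (hD : G.IsGood T L i D) {u w : V} (hu : u ∈ D.drawn)
    (hw : w ∈ D.drawn) (h : T.Unrelated u w) (hlt : G.index T u < G.index T w) (m : ℤ)
    (hmu : m < D.bottom u) (hmw : m < D.bottom w) (htu : G.topSide T D u ≤ m)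
    (htw : G.topSide T D w ≤ m)
    (hb : ∀ x ∈ D.drawn, T.Unrelated u x → T.Unrelated x w → G.index T u < G.index T x →
      G.index T x < G.index T w → D.bottom x ≤ m) :
    SeesRight D.drawn (G.rect T D) u w := by
  have cast : ∀ {a b : ℤ}, a ≤ b → (a : ℝ) ≤ b := fun h => Int.cast_le.2 h
  have cast' : ∀ {a b : ℤ}, a < b → (a : ℝ) + 1 ≤ b := fun h => by exact_mod_cast h
  -- The segment runs along the middle of the row, away from all integer coordinates.
  refine ⟨hD.apart u w hw h hlt, (m : ℝ) + 1 / 2, ⟨?_, ?_⟩, ⟨?_, ?_⟩, ?_⟩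
  · have := cast htu
    change (G.topSide T D u : ℝ) < _
    linarith
  · have := cast' hmu
    change _ < (D.bottom u : ℝ)
    linarith
  · have := cast htw
    change (G.topSide T D w : ℝ) < _
    linarith
  · have := cast' hmw
    change _ < (D.bottom w : ℝ)
    linarith
  · rintro k hk hku hkw x ⟨hx₁, hx₂⟩ ⟨⟨hx₃, hx₄⟩, hy₁, hy₂⟩
    change (D.right u : ℝ) ≤ x at hx₁
    change x ≤ (D.left w : ℝ) at hx₂
    change (D.left k : ℝ) ≤ x at hx₃
    change x ≤ (D.right k : ℝ) at hx₄
    change (G.topSide T D k : ℝ) ≤ (m : ℝ) + 1 / 2 at hy₁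
    change (m : ℝ) + 1 / 2 ≤ (D.bottom k : ℝ) at hy₂
    by_cases h₁ : T.Above k u
    · have := cast ((hD.bottom_le_topSide hC hu ⟨hku, h₁⟩).trans htu)
      linarith
    by_cases h₂ : T.Above k w
    · have := cast ((hD.bottom_le_topSide hC hw ⟨hkw, h₂⟩).trans htw)
      linarith
    by_cases h₃ : T.Above u k
    · have := cast' (hmu.trans_le (hD.bottom_le_topSide hC hk ⟨Ne.symm hku, h₃⟩))
      linarith
    by_cases h₄ : T.Above w k
    · have := cast' (hmw.trans_le (hD.bottom_le_topSide hC hk ⟨Ne.symm hkw, h₄⟩))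
      linarith
    have huk : T.Unrelated u k := unrelated_iff.2 ⟨h₃, h₁⟩
    have hkw' : T.Unrelated k w := unrelated_iff.2 ⟨h₂, h₄⟩
    rcases lt_trichotomy (G.index T u) (G.index T k) with h₅ | h₅ | h₅
    · rcases lt_trichotomy (G.index T k) (G.index T w) with h₆ | h₆ | h₆
      · have := cast (hb k hk huk hkw' h₅ h₆)
        linarith
      · exact hkw (index_injective hC h₆)
      · have h₇ := hD.apart w k hk hkw'.symm h₆
        have h₈ := hD.width w hw
        have := cast' (show D.left w < D.left k by omega)
        linarith
    · exact hku (index_injective hC h₅).symm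
    · have h₇ := hD.apart k u hu huk.symm h₅
      have h₈ := hD.width u hu
      have := cast' (show D.right k < D.right u by omega)
      linarith

theorem unrelated_of_mustSee (hT : G.IsOrderlySpanningTree T) {u w : V}
    (h : G.MustSee T D u w) : T.Unrelated u w :=
  ((adj_cases hT h.2.2.1).resolve_left h.2.2.2.1).resolve_left h.2.2.2.2

/-- A node that is too short has not yet reached its level. -/
theorem bottom_lt_of_isTooShort (hT : G.IsOrderlySpanningTree T) (hL : G.IsLevel T L)
    (hD : G.IsGood T L i D) {u : V} (h : G.IsTooShort T D u) : D.bottom u < L u := by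
  have hC := hasCcwChildren hT
  obtain ⟨w, hm, hv, hle⟩ := h
  by_contra! hlev
  have hun := unrelated_of_mustSee hT hm
  obtain ⟨hu, hw, hadj, -, -⟩ := hm
  have htu := hD.height u hu
  have htw : G.topSide T D w < D.bottom u := by
    have h₁ := hL.parent_lt_of_adj w u hadj.symm hun.symm
    have h₂ := hD.level _ (hD.parent_mem hC hw)
    rw [topSide_of_ne hun.ne_root_right]
    omega
  rcases lt_trichotomy (G.index T u) (G.index T w) with h | h | h
  · refine hv (Or.inl (hD.seesRight hC hu hw hun h (D.bottom u - 1) ?_ ?_ ?_ ?_ ?_))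
    · omega
    · omega
    · omega
    · omega
    · intro x hx h₁ h₂ h₃ h₄
      have h₅ := (hL.lt_of_between u w x hadj hun h₁ h₂ h₃ h₄).1
      have h₆ := hD.level x hx
      omega
  · exact hun.1 (index_injective hC h)
  · refine hv (Or.inr (hD.seesRight hC hw hu hun.symm h (D.bottom u - 1) ?_ ?_ ?_ ?_ ?_))
    · omega
    · omega
    · omega
    · omega
    · intro x hx h₁ h₂ h₃ h₄
      have h₅ := (hL.lt_of_between w u x hadj.symm hun.symm h₁ h₂ h₃ h₄).2
      have h₆ := hD.level x hx
      omega

/-! ### Step 3 -/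

/-- A pushed node ends one unit below its parent, which is strictly above its own level; the level
grows by at least one from parent to child. -/
theorem bottom_lt_of_movesWith (hT : G.IsOrderlySpanningTree T) (hL : G.IsLevel T L)
    (hD : G.IsGood T L i D) {u x : V} (hu : G.IsTooShort T D u) (h : G.MovesWith T D u x) :
    D.bottom x < L x := by
  induction hn : T.depth x generalizing x with
  | zero =>
    rcases h with rfl | h
    · exact hD.bottom_lt_of_isTooShort hT hL hu
    · have := depth_parent h.1.ne_root
      omega
  | succ n ih =>
    by_cases hxu : x = u
    · subst hxu
      exact hD.bottom_lt_of_isTooShort hT hL hu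
    · have hx : x ≠ T.root := by
        rintro rfl
        rw [depth_root] at hn
        omega
      have hd := depth_parent hx
      obtain ⟨h₁, h₂⟩ := (movesWith_parent_iff hx hxu).1 h
      have h₃ := ih h₁ (by omega)
      have h₄ := hL.parent_lt x hx
      omega

protected theorem lengthen (hT : G.IsOrderlySpanningTree T) (hL : G.IsLevel T L)
    (hD : G.IsGood T L i D) : G.IsGood T L i (G.lengthen T D) where
  mem_drawn := hD.mem_drawn
  width := hD.width
  nested := hD.nested
  apart := hD.apart
  left_root := hD.left_root
  right_root := hD.right_root
  height v hv := by
    have hv : v ∈ D.drawn := hv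
    have h := hD.height v hv
    have h₁ := bottom_lengthen_le (G := G) (T := T) D v
    by_cases hr : v = T.root
    · subst hr
      rw [topSide_root] at h ⊢
      omega
    rw [topSide_of_ne hr] at h ⊢
    have h₂ := bottom_lengthen_le (G := G) (T := T) D (T.parent v)
    -- Only a child of height one could be squeezed, and such a child moves whenever its parent
    -- does.
    by_cases hb : D.bottom v = D.bottom (T.parent v) + 1
    · by_cases hp : ∃ u, G.IsTooShort T D u ∧ G.MovesWith T D u (T.parent v)
      · have hv' : ∃ u, G.IsTooShort T D u ∧ G.MovesWith T D u v := by
          obtain ⟨u, hu, hup⟩ := hp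
          by_cases hvu : v = u
          · exact ⟨u, hu, Or.inl hvu⟩
          · exact ⟨u, hu, (movesWith_parent_iff hr hvu).2 ⟨hup, hb⟩⟩
        have h₃ : (G.lengthen T D).bottom v = D.bottom v + 1 := by
          simp only [lengthen]
          rw [if_pos ⟨hv, hv'⟩]
        omega
      · have h₃ : (G.lengthen T D).bottom (T.parent v) = D.bottom (T.parent v) := by
          simp only [lengthen]
          rw [if_neg fun h => hp h.2]
        omega
    · omega
  level v hv := by
    simp only [lengthen]
    split_ifs with h
    · obtain ⟨-, u, hu, huv⟩ := h
      have := hD.bottom_lt_of_movesWith hT hL hu huv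
      omega
    · exact hD.level v hv

/-- The total distance of the drawn bottom sides from their levels is a natural number that
decreases in every unsettled round. -/
theorem exists_isSettled (hT : G.IsOrderlySpanningTree T) (hL : G.IsLevel T L)
    (hD : G.IsGood T L i D) : ∃ k, G.IsSettled T ((G.lengthen T)^[k] D) := by
  classical
  have := Fintype.ofFinite V
  induction hn : ∑ v, (if v ∈ D.drawn then (L v - D.bottom v).toNat else 0)
    using Nat.strong_induction_on generalizing D with
  | _ n ih =>
  subst hn
  by_cases hs : G.IsSettled T D
  · exact ⟨0, hs⟩
  obtain ⟨u, hud, hu⟩ := exists_isTooShort hs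
  have hlt : ∑ v, (if v ∈ (G.lengthen T D).drawn then
      (L v - (G.lengthen T D).bottom v).toNat else 0) <
      ∑ v, (if v ∈ D.drawn then (L v - D.bottom v).toNat else 0) := by
    have hdr : (G.lengthen T D).drawn = D.drawn := rfl
    rw [hdr]
    refine Finset.sum_lt_sum (fun v _ => ?_) ⟨u, Finset.mem_univ _, ?_⟩
    · have := bottom_lengthen_le (G := G) (T := T) D v
      split_ifs <;> omega
    · have h₁ := hD.bottom_lt_of_isTooShort hT hL hu
      have h₂ : (G.lengthen T D).bottom u = D.bottom u + 1 := by
        simp only [lengthen]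
        rw [if_pos ⟨hud, u, hu, Or.inl rfl⟩]
      rw [if_pos hud, if_pos hud, h₂]
      omega
  obtain ⟨k, hk⟩ := ih _ hlt (hD.lengthen hT hL) rfl
  exact ⟨k + 1, by rwa [Function.iterate_succ_apply]⟩

theorem drawStep3 (hT : G.IsOrderlySpanningTree T) (hL : G.IsLevel T L)
    (hD : G.IsGood T L i D) :
    ∃ D', G.drawStep3 T D = some D' ∧ G.IsGood T L i D' ∧ G.IsSettled T D' := by
  classical
  have h := hD.exists_isSettled hT hL
  refine ⟨_, dif_pos h, ?_, Nat.find_spec h⟩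
  induction Nat.find h with
  | zero => exact hD
  | succ k ih =>
    rw [Function.iterate_succ_apply']
    exact ih.lengthen hT hL

end IsGood

/-! ### Steps 1 and 2 -/

open scoped Classical in
/-- How much Step 1 for `v` lengthens the ancestors of `v`. -/
noncomputable def step1Shift (G : PlaneGraph V) (T : RootedSpanningTree G.graph) (v : V) : ℤ :=
  if G.IsLaterChild T v then 1 else 0

/-- The drawing after Steps 1 and 2 for a node `v` other than the root. -/
theorem step12_eq {v : V} (hv : v ≠ T.root) (D : DrawState V) :
    let D' := G.drawStep2 T v (G.drawStep1 T v D)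
    D'.drawn = insert v D.drawn ∧
    (∀ u, u ≠ v → D'.left u = D.left u ∧ D'.bottom u = D.bottom u ∧
      (T.IsAncestor u v → D'.right u = D.right u + G.step1Shift T v) ∧
      (¬ T.IsAncestor u v → D'.right u = D.right u)) ∧
    D'.right v = D.right (T.parent v) + G.step1Shift T v ∧
    D'.left v = D.right (T.parent v) + G.step1Shift T v - 1 ∧
    D'.bottom v = D.bottom (T.parent v) + 1 := by
  classical
  have hright : ∀ u, (G.drawStep1 T v D).right u =
      if T.IsAncestor u v then D.right u + G.step1Shift T v else D.right u := by
    intro u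
    by_cases h : G.IsLaterChild T v
    · have h' : v ≠ T.root ∧ (G.ccwChildren T (T.parent v)).head? ≠ some v := h
      rw [drawStep1, if_pos h', step1Shift, if_pos h]
    · have h' : ¬ (v ≠ T.root ∧ (G.ccwChildren T (T.parent v)).head? ≠ some v) := h
      rw [drawStep1, if_neg h', step1Shift, if_neg h, add_zero, ite_self]
  have hrest : (G.drawStep1 T v D).left = D.left ∧ (G.drawStep1 T v D).bottom = D.bottom ∧
      (G.drawStep1 T v D).drawn = D.drawn := by
    rw [drawStep1]
    split_ifs <;> exact ⟨rfl, rfl, rfl⟩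
  have hp := hright (T.parent v)
  rw [if_pos (isAncestor_parent hv)] at hp
  refine ⟨?_, fun u hu => ⟨?_, ?_, fun h => ?_, fun h => ?_⟩, ?_, ?_, ?_⟩
  · simp only [drawStep2, hrest]
  · simp only [drawStep2, Function.update_of_ne hu, hrest]
  · simp only [drawStep2, Function.update_of_ne hu, hrest]
  · simp only [drawStep2, Function.update_of_ne hu]
    rw [hright, if_pos h]
  · simp only [drawStep2, Function.update_of_ne hu]
    rw [hright, if_neg h]
  · simp only [drawStep2, Function.update_self, if_neg hv]
    exact hp
  · simp only [drawStep2, Function.update_self, if_neg hv]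
    rw [hp]
  · simp only [drawStep2, Function.update_self, topSide_of_ne hv, hrest]

theorem step12_root_eq (D : DrawState V) :
    let D' := G.drawStep2 T T.root (G.drawStep1 T T.root D)
    D'.drawn = insert T.root D.drawn ∧ D'.left T.root = 0 ∧ D'.right T.root = 1 ∧
      D'.bottom T.root = 1 := by
  classical
  have h : G.drawStep1 T T.root D = D := if_neg fun h => h.1 rfl
  rw [h]
  refine ⟨rfl, ?_, ?_, ?_⟩ <;> simp [drawStep2, topSide_root]

theorem ncard_laterChild_succ [Finite V] (hC : G.HasCcwChildren T) (v : V) :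
    ({u | G.IsLaterChild T u ∧ G.index T u < G.index T v + 1}.ncard : ℤ) =
      {u | G.IsLaterChild T u ∧ G.index T u < G.index T v}.ncard + G.step1Shift T v := by
  classical
  by_cases h : G.IsLaterChild T v
  · have : {u | G.IsLaterChild T u ∧ G.index T u < G.index T v + 1} =
        insert v {u | G.IsLaterChild T u ∧ G.index T u < G.index T v} := by
      ext u
      simp only [Set.mem_ofPred_eq, Set.mem_insert_iff, Nat.lt_succ_iff_lt_or_eq]
      constructor
      · rintro ⟨h₁, h₂ | h₂⟩
        · exact Or.inr ⟨h₁, h₂⟩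
        · exact Or.inl (index_injective hC h₂)
      · rintro (rfl | ⟨h₁, h₂⟩)
        · exact ⟨h, Or.inr rfl⟩
        · exact ⟨h₁, Or.inl h₂⟩
    rw [this, Set.ncard_insert_of_notMem (by simp), step1Shift, if_pos h]
    push_cast
    ring
  · have : {u | G.IsLaterChild T u ∧ G.index T u < G.index T v + 1} =
        {u | G.IsLaterChild T u ∧ G.index T u < G.index T v} := by
      ext u
      simp only [Set.mem_ofPred_eq, Nat.lt_succ_iff_lt_or_eq]
      constructor
      · rintro ⟨h₁, h₂ | h₂⟩
        · exact ⟨h₁, h₂⟩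
        · rw [index_injective hC h₂] at h₁
          exact absurd h₁ h
      · rintro ⟨h₁, h₂⟩
        exact ⟨h₁, Or.inl h₂⟩
    rw [this, step1Shift, if_neg h, add_zero]

namespace IsGood

variable [Finite V] {L : V → ℤ} {D : DrawState V}

theorem step12_root (hC : G.HasCcwChildren T) (hL : G.IsLevel T L)
    (hD : G.IsGood T L (G.index T T.root) D) :
    G.IsGood T L (G.index T T.root + 1) (G.drawStep2 T T.root (G.drawStep1 T T.root D)) := by
  obtain ⟨hdr, hl, hr, hb⟩ := step12_root_eq (G := G) (T := T) D
  have hmem : ∀ v, v ∈ (G.drawStep2 T T.root (G.drawStep1 T T.root D)).drawn ↔ v = T.root := by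
    intro v
    rw [hdr, Set.mem_insert_iff, hD.mem_drawn]
    refine or_iff_left fun h => ?_
    have := index_le_of_above hC (root_above (T := T) v)
    omega
  constructor
  · intro v
    rw [hmem]
    constructor
    · rintro rfl
      omega
    · intro h
      have := index_le_of_above hC (root_above (T := T) v)
      exact index_injective hC (by omega)
  · intro v hv
    rw [(hmem v).1 hv, hl, hr]
    omega
  · intro a v hv h
    exact absurd ((hmem v).1 hv) h.ne_root
  · intro u v hv h
    exact absurd ((hmem v).1 hv) h.ne_root_right
  · intro v hv
    rw [(hmem v).1 hv, topSide_root, hb]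
    omega
  · intro v hv
    rw [(hmem v).1 hv, hb]
    exact hL.one_le _
  · intro _
    exact hl
  · intro _
    have : {v | G.IsLaterChild T v ∧ G.index T v < G.index T T.root + 1} = ∅ := by
      ext v
      simp only [Set.mem_ofPred_eq, Set.mem_empty_iff_false, iff_false]
      rintro ⟨h, h'⟩
      have := index_le_of_above hC (root_above (T := T) v)
      exact h.1 (index_injective hC (by omega))
    rw [hr, this]
    simp

theorem step12_nonroot (hC : G.HasCcwChildren T) (hL : G.IsLevel T L) {v : V} (hv : v ≠ T.root)
    (hD : G.IsGood T L (G.index T v) D) :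
    G.IsGood T L (G.index T v + 1) (G.drawStep2 T v (G.drawStep1 T v D)) := by
  classical
  obtain ⟨hdr, hne, hrv, hlv, hbv⟩ := step12_eq hv D
  set D' := G.drawStep2 T v (G.drawStep1 T v D) with hD'
  have hv' : v ∉ D.drawn := by rw [hD.mem_drawn]; omega
  have hne' : ∀ u ∈ D.drawn, u ≠ v := by rintro u hu rfl; exact hv' hu
  have hp : T.parent v ∈ D.drawn := (hD.mem_drawn _).2 (index_parent_lt hC hv)
  have hpv := isAncestor_parent hv
  have hshift : G.step1Shift T v = 0 ∨ G.step1Shift T v = 1 := by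
    rw [step1Shift]
    split_ifs <;> simp
  have htop : ∀ u ∈ D.drawn, G.topSide T D' u = G.topSide T D u := by
    intro u hu
    by_cases hr : u = T.root
    · rw [hr, topSide_root, topSide_root]
    · rw [topSide_of_ne hr, topSide_of_ne hr, (hne _ (hne' _ (hD.parent_mem hC hu))).2.1]
  have hwp := hD.width _ hp
  constructor
  · intro u
    rw [hdr, Set.mem_insert_iff, hD.mem_drawn, Nat.lt_succ_iff_lt_or_eq, or_comm]
    exact or_congr Iff.rfl ⟨fun h => by rw [h], fun h => index_injective hC h⟩
  · intro u hu
    rw [hdr] at hu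
    rcases hu with rfl | hu
    · omega
    · obtain ⟨h₁, -, h₂, h₃⟩ := hne u (hne' u hu)
      have h₄ := hD.width u hu
      by_cases ha : T.IsAncestor u v
      · have := h₂ ha
        omega
      · have := h₃ ha
        omega
  · intro a u hu hau
    rw [hdr] at hu
    rcases hu with rfl | hu
    · obtain ⟨h₁, -, h₂, -⟩ := hne a hau.1
      have h₃ := h₂ hau
      by_cases hap : a = T.parent u
      · subst hap
        omega
      · have h₄ := hD.nested a _ hp ⟨hap, (isAncestor_iff_parent.1 hau).2⟩
        omega
    · have hav : a ≠ v := by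
        rintro rfl
        have := (hD.mem_drawn u).1 hu
        have := index_lt_of_isAncestor hC hau
        omega
      obtain ⟨h₁, -, h₂, h₃⟩ := hne a hav
      obtain ⟨h₁', -, h₂', h₃'⟩ := hne u (hne' u hu)
      have h₄ := hD.nested a u hu hau
      by_cases ha : T.IsAncestor a v
      · have := h₂ ha
        by_cases hu' : T.IsAncestor u v
        · have := h₂' hu'
          omega
        · have := h₃' hu'
          omega
      · have := h₃ ha
        have := h₃' fun hu' => ha ⟨hav, hau.above.trans hu'.above⟩
        omega
  · intro u x hx hux hlt
    rw [hdr] at hx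
    rcases hx with rfl | hx
    · obtain ⟨-, -, -, h₃⟩ := hne u hux.1
      have hu := (hD.mem_drawn u).2 hlt
      rw [h₃ hux.2.1, hlv]
      have hup : ¬ T.Above u (T.parent x) := fun h =>
        (unrelated_iff.1 hux).1 (h.trans (above_parent x))
      -- If `u` is below the parent of the new node, the new node is a later child, and the unit
      -- just added to the parent is the column it takes. Otherwise `u` lies entirely to the left of
      -- the parent.
      by_cases hpu : T.Above (T.parent x) u
      · have hne : T.parent x ≠ u := fun h => hup (by rw [h]; exact Above.refl _ _)
        have h₄ := hD.nested _ u hu ⟨hne, hpu⟩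
        have h₅ : G.step1Shift T x = 1 := by
          rw [step1Shift, if_pos]
          refine ⟨hv, fun h => ?_⟩
          obtain ⟨l, hl⟩ := List.head?_eq_some_iff.1 h
          have h₆ := index_le_of_lt_first_child hC hl hlt
          have h₇ := index_lt_of_isAncestor hC ⟨hne, hpu⟩
          omega
        omega
      · have hlt' : G.index T u < G.index T (T.parent x) := by
          by_contra! h
          exact hpu (above_of_index_le hC hpv.above h hlt.le)
        have h₄ := hD.apart u _ hp (unrelated_iff.2 ⟨hup, hpu⟩) hlt'
        omega
    · have hxi := (hD.mem_drawn x).1 hx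
      have hu : u ∈ D.drawn := (hD.mem_drawn u).2 (hlt.trans hxi)
      obtain ⟨-, -, -, h₃⟩ := hne u (hne' u hu)
      rw [h₃, (hne x (hne' x hx)).1]
      · exact hD.apart u x hx hux hlt
      -- Only ancestors of `v` are widened. Were `u` one of them, `x`, lying between `u` and `v` in
      -- the preorder, would be below `u`.
      · intro h
        exact (unrelated_iff.1 hux).1 (above_of_index_le hC h.above hlt.le hxi.le)
  · intro u hu
    rw [hdr] at hu
    rcases hu with rfl | hu
    · rw [topSide_of_ne hv, hbv, (hne _ (hne' _ hp)).2.1]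
    · rw [htop u hu, (hne u (hne' u hu)).2.1]
      exact hD.height u hu
  · intro u hu
    rw [hdr] at hu
    rcases hu with rfl | hu
    · have h₁ := hD.level _ hp
      have h₂ := hL.parent_lt u hv
      omega
    · rw [(hne u (hne' u hu)).2.1]
      exact hD.level u hu
  · intro hr
    rw [(hne _ hv.symm).1]
    rw [hdr] at hr
    exact hD.left_root (hr.resolve_left hv.symm)
  · intro hr
    rw [hdr] at hr
    rw [(hne _ hv.symm).2.2.1 ⟨hv.symm, root_above v⟩, hD.right_root (hr.resolve_left hv.symm),
      ncard_laterChild_succ hC]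
    ring

theorem step12 (hC : G.HasCcwChildren T) (hL : G.IsLevel T L) {v : V}
    (hD : G.IsGood T L (G.index T v) D) :
    G.IsGood T L (G.index T v + 1) (G.drawStep2 T v (G.drawStep1 T v D)) := by
  by_cases hv : v = T.root
  · subst hv
    exact hD.step12_root hC hL
  · exact hD.step12_nonroot hC hL hv

theorem foldlM (hT : G.IsOrderlySpanningTree T) (hL : G.IsLevel T L) (l₂ l₁ : List V)
    (h : G.preorder T = l₁ ++ l₂) (hD : G.IsGood T L l₁.length D) (hs : G.IsSettled T D) :
    ∃ D', l₂.foldlM (G.drawIteration T) D = some D' ∧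
      G.IsGood T L (G.preorder T).length D' ∧ G.IsSettled T D' := by
  classical
  have hC := hasCcwChildren hT
  induction l₂ generalizing l₁ D with
  | nil => exact ⟨D, rfl, by rwa [h, List.append_nil], hs⟩
  | cons v l ih =>
    have hidx : G.index T v = l₁.length := by
      have hnd := nodup_preorder hC
      rw [h] at hnd
      rw [index, h, List.idxOf_append_of_notMem, List.idxOf_cons_self, add_zero]
      exact fun hv => (List.nodup_append.1 hnd).2.2 v hv v (by simp) rfl
    rw [← hidx] at hD
    obtain ⟨D₁, h₁, h₂, h₃⟩ := (hD.step12 hC hL).drawStep3 hT hL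
    obtain ⟨D₂, h₄, h₅⟩ := ih (l₁ ++ [v]) (by rw [h]; simp) (by simpa [hidx] using h₂) h₃
    refine ⟨D₂, ?_, h₅⟩
    rw [List.foldlM_cons]
    change (G.drawStep3 T _ >>= _) = _
    rw [h₁]
    exact h₄

/-! ## The complete drawing -/

theorem isTwoVisibilityDrawing (hT : G.IsOrderlySpanningTree T) {i : ℕ} (hD : G.IsGood T L i D)
    (hs : G.IsSettled T D) (hdr : D.drawn = Set.univ) :
    IsTwoVisibilityDrawing G.graph (G.rect T D) := by
  have hC := hasCcwChildren hT
  have hmem : ∀ v, v ∈ D.drawn := fun v => by rw [hdr]; trivial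
  have cast : ∀ {a b : ℤ}, a ≤ b → (a : ℝ) ≤ b := fun h => Int.cast_le.2 h
  have cast' : ∀ {a b : ℤ}, a + 1 ≤ b → (a : ℝ) + 1 ≤ b := fun h => by exact_mod_cast h
  have hchild : ∀ p c, T.IsChild c p → SeesDown Set.univ (G.rect T D) p c := by
    rintro p c hc
    have hpc := hc.isAncestor
    obtain ⟨hc, rfl⟩ := hc
    have hn := hD.nested _ c (hmem c) hpc
    have hw := hD.width c (hmem c)
    have hw' := cast' hw
    have hh := hD.height c (hmem c)
    have hhp := hD.height _ (hmem (T.parent c))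
    have htop := topSide_of_ne hc D
    -- The vertical segment degenerates to a point on the common side, half a unit from the left end
    -- of `c`.
    refine ⟨htop.ge, (D.left c : ℝ) + 1 / 2, ⟨?_, ?_⟩, ⟨?_, ?_⟩, ?_⟩
    · have := cast hn.1
      change (D.left _ : ℝ) < _
      linarith
    · have := cast hn.2
      change _ < (D.right _ : ℝ)
      linarith
    · change (D.left c : ℝ) < _
      linarith
    · change _ < (D.right c : ℝ)
      linarith
    · rintro k - hkp hkc y ⟨hy₁, hy₂⟩ ⟨⟨hx₁, hx₂⟩, hy₃, hy₄⟩
      change (D.bottom (T.parent c) : ℝ) ≤ y at hy₁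
      change y ≤ (G.topSide T D c : ℝ) at hy₂
      change (D.left k : ℝ) ≤ (D.left c : ℝ) + 1 / 2 at hx₁
      change (D.left c : ℝ) + 1 / 2 ≤ (D.right k : ℝ) at hx₂
      change (G.topSide T D k : ℝ) ≤ y at hy₃
      change y ≤ (D.bottom k : ℝ) at hy₄
      by_cases h₁ : T.Above k c
      -- A higher ancestor ends strictly above this point, because the parent of `c` has height at
      -- least one.
      · have h₂ : T.IsAncestor k (T.parent c) := ⟨hkp, (above_iff_eq_or.1 h₁).resolve_left hkc⟩
        have h₃ := hD.bottom_le_topSide hC (hmem _) h₂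
        have := cast' (show D.bottom k + 1 ≤ D.bottom (T.parent c) by omega)
        linarith
      by_cases h₂ : T.Above c k
      · have h₃ := hD.bottom_le_topSide hC (hmem k) ⟨Ne.symm hkc, h₂⟩
        have := cast' (show G.topSide T D c + 1 ≤ G.topSide T D k by omega)
        linarith
      rcases lt_trichotomy (G.index T k) (G.index T c) with h₃ | h₃ | h₃
      · have := cast (hD.apart k c (hmem c) (unrelated_iff.2 ⟨h₁, h₂⟩) h₃)
        linarith
      · exact hkc (index_injective hC h₃)
      · have := cast (hD.apart c k (hmem k) (unrelated_iff.2 ⟨h₂, h₁⟩) h₃)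
        linarith
  refine ⟨fun v => hD.width v (hmem v), fun v => hD.height v (hmem v), ?_, ?_⟩
  · have hint : ∀ v, interior (G.rect T D v).region =
        Set.Ioo (D.left v : ℝ) (D.right v) ×ˢ Set.Ioo (G.topSide T D v : ℝ) (D.bottom v) := by
      intro v
      rw [Rect.region, interior_prod_eq, interior_Icc, interior_Icc]
      rfl
    have hanc : ∀ a v, T.IsAncestor a v →
        Disjoint (interior (G.rect T D a).region) (interior (G.rect T D v).region) := by
      intro a v h
      rw [hint, hint, Set.disjoint_left]
      rintro ⟨x, y⟩ ⟨-, h₁⟩ ⟨-, h₂⟩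
      have := cast (hD.bottom_le_topSide hC (hmem v) h)
      have := h₁.2
      have := h₂.1
      dsimp only at *
      linarith
    have hunr : ∀ u v, T.Unrelated u v → G.index T u < G.index T v →
        Disjoint (interior (G.rect T D u).region) (interior (G.rect T D v).region) := by
      intro u v h hlt
      rw [hint, hint, Set.disjoint_left]
      rintro ⟨x, y⟩ ⟨h₁, -⟩ ⟨h₂, -⟩
      have := cast (hD.apart u v (hmem v) h hlt)
      have := h₁.2
      have := h₂.1
      dsimp only at *
      linarith
    intro u v huv
    by_cases h₁ : T.IsAncestor u v
    · exact hanc u v h₁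
    by_cases h₂ : T.IsAncestor v u
    · exact (hanc v u h₂).symm
    rcases lt_trichotomy (G.index T u) (G.index T v) with h | h | h
    · exact hunr u v ⟨huv, h₁, h₂⟩ h
    · exact absurd (index_injective hC h) huv
    · exact (hunr v u ⟨huv.symm, h₂, h₁⟩ h).symm
  · intro u v h
    by_cases h₁ : T.IsChild u v
    · exact Or.inr (Or.inr (hchild v u h₁))
    by_cases h₂ : T.IsChild v u
    · exact Or.inr (Or.inl (hchild u v h₂))
    · left
      rw [← hdr]
      exact hs u v ⟨hmem u, hmem v, h, h₁, h₂⟩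

theorem drawingHeight_le (hC : G.HasCcwChildren T) (hL : G.IsLevel T L) {i : ℕ}
    (hD : G.IsGood T L i D) (hdr : D.drawn = Set.univ) :
    drawingHeight (G.rect T D) ≤ (Nat.card V : ℤ) - 1 := by
  have hmem : ∀ v, v ∈ D.drawn := fun v => by rw [hdr]; trivial
  have : Nonempty V := ⟨T.root⟩
  have h₁ : ⨆ v, (G.rect T D v).bottom ≤ (Nat.card V : ℤ) - 1 :=
    ciSup_le fun v => (hD.level v (hmem v)).trans (hL.le_card v)
  -- The root starts at 0 and nothing starts above it, so the height is bounded by the largest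
  -- level.
  have h₂ : 0 ≤ ⨅ v, (G.rect T D v).top := by
    refine le_ciInf fun v => ?_
    change 0 ≤ G.topSide T D v
    by_cases hv : v = T.root
    · rw [hv, topSide_root]
    · have h₃ := hD.bottom_le_topSide hC (hmem v) ⟨Ne.symm hv, root_above v⟩
      have h₄ := hD.height T.root (hmem _)
      rw [topSide_root] at h₄
      omega
  rw [drawingHeight]
  omega

theorem drawingWidth_eq (hC : G.HasCcwChildren T) {i : ℕ} (hD : G.IsGood T L i D)
    (hdr : D.drawn = Set.univ) : drawingWidth (G.rect T D) = (T.numLeaves : ℤ) := by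
  have hmem : ∀ v, v ∈ D.drawn := fun v => by rw [hdr]; trivial
  have : Nonempty V := ⟨T.root⟩
  have hin : ∀ v, D.left T.root ≤ D.left v ∧ D.right v ≤ D.right T.root := by
    intro v
    by_cases hv : v = T.root
    · rw [hv]
      exact ⟨le_rfl, le_rfl⟩
    · exact hD.nested _ v (hmem v) ⟨Ne.symm hv, root_above v⟩
  have h₁ : ⨆ v, (G.rect T D v).right = D.right T.root :=
    le_antisymm (ciSup_le fun v => (hin v).2)
      (le_ciSup (f := fun v => (G.rect T D v).right) (Set.finite_range _).bddAbove T.root)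
  have h₂ : ⨅ v, (G.rect T D v).left = D.left T.root :=
    le_antisymm (ciInf_le (f := fun v => (G.rect T D v).left) (Set.finite_range _).bddBelow T.root)
      (le_ciInf fun v => (hin v).1)
  have h₃ : {v | G.IsLaterChild T v ∧ G.index T v < i} = {v | G.IsLaterChild T v} := by
    ext v
    exact and_iff_left ((hD.mem_drawn v).1 (hmem v))
  rw [drawingWidth, h₁, h₂, hD.left_root (hmem _), hD.right_root (hmem _), h₃, numLeaves_eq hC]
  push_cast
  ring

end IsGood

end PlaneGraph

theorem mainTheorem6 {V : Type*} [Finite V] (G : PlaneGraph V) (hG : G.IsTriangulation)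
    (T : RootedSpanningTree G.graph) (hT : G.IsOrderlySpanningTree T) :
    ∃ R : V → Rect, G.draw T = some R ∧
      IsTwoVisibilityDrawing G.graph R ∧
      drawingHeight R ≤ (Nat.card V : ℤ) - 1 ∧
      drawingWidth R = (T.numLeaves : ℤ) := by
  classical
  have hC := PlaneGraph.hasCcwChildren hT
  obtain ⟨L, hL⟩ := PlaneGraph.exists_isLevel hG hT
  obtain ⟨D, h, hD, hs⟩ := PlaneGraph.IsGood.foldlM hT hL (G.preorder T) [] rfl
    PlaneGraph.isGood_emptyState fun u w h => h.1.elim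
  have hdr : D.drawn = Set.univ := Set.eq_univ_of_forall fun v =>
    (hD.mem_drawn v).2 (List.idxOf_lt_length_iff.2 (PlaneGraph.mem_preorder hC v))
  refine ⟨G.rect T D, ?_, hD.isTwoVisibilityDrawing hT hs hdr, hD.drawingHeight_le hC hL hdr,
    hD.drawingWidth_eq hC hdr⟩
  rw [PlaneGraph.draw, h]
  rfl
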